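/- Fix a dimension $d\ge 2$. Write $|A|$ for the Lebesgue measure of a (Lebesgue) measurable set $A\subset\mathbb R^d$, $Q(x,r)$ for the open axis-parallel cube of side length $r$ centred at $x$, $d_{Q(x,r)}(A)=|A\cap Q(x,r)|/|Q(x,r)|$, and $\bar d(A)=\limsup_{R\to\infty}d_{Q(0,R)}(A)$. A *property* is a function $P$ assigning to each measurable set $A\subset\mathbb R^d$ a value $0$ or $1$ ("$A$ has $P$" if $P(A)=1$). Put $m(P)=\sup_{P(A)=1}\bar d(A)$; for $t>0$ let $t\cdot P$ be the property that holds for $A$ exactly when $P$ holds for $(1/t)\cdot A$; and let $P_1\text{ AND }\dotsb\text{ AND }P_n$ be the property that all $P_i$ hold. For $\delta>0$ and real $\epsilon$ let $\mathcal Z_\delta(\epsilon)A=\{x: |Q(x,\delta)\cap A|>\epsilon|Q(x,\delta)|\}$. A property $P$ is *supersaturable* if there is a function $I_P$ from the measurable sets to $[0,\infty]$ such that, for all measurable sets: (I) $m(P)>0$. (II) If $A\supset B$, then $I_P(A)\ge I_P(B)$ and $P(A)\le P(B)$. (III) If $I_P(A)>0$, then $A$ does not have $P$. (IV) $P(A+x)=P(A)$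 and $I_P(A+x)=I_P(A)$ for every $x\in\mathbb R^d$. (V) There is a real number $D$ such that $I_P(A_1\cup A_2)\ge I_P(A_1)+I_P(A_2)$ whenever $A_1,A_2$ are at Euclidean distance at least $D$ from each other, and such that for every finite or countably infinite family of sets $A_1,A_2,\dotsc$ that are pairwise at distance at least $D$, the union $\bigcup_k A_k$ has $P$ if and only if every $A_k$ has $P$. (VI) There are $\epsilon>0$ and a function $f\colon(0,\infty)\to(0,\infty)$ such that for every $\delta>0$, if $\mathcal Z_\delta(1-\epsilon)A$ does not have $P$, then $I_P(A)\ge f(\delta)$. (VII) There are functions $g(\epsilon)>0$ and $h(\epsilon,\delta)\ge 0$ $(\epsilon,\delta>0)$ with $h(\epsilon,\delta)\to0$ as $\delta\to0^+$ for every fixed $\epsilon>0$, such that $I_P(A)\ge g(\epsilon)I_P(\mathcal Z_\delta(\epsilon)A)-h(\epsilon,\delta)R^d$ for all $\epsilon,\delta,R>0$ and all $A\subset Q(0,R)$. **Theorem.** Let $P_1,\dotsc,P_n$ be supersaturable properties. Then for all $t_1,\dotsc,t_n>0$ $$m(t_1\cdot P_1\text{ AND }\dotsb\text{ AND }t_n\cdot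 P_n)\ \ge\ \prod_{i=1}^n m(P_i),$$ and if $t_1,\dotsc,t_n>0$ vary in such a way that for all $i\ne j$ the ratio $t_i/t_j$ tends either to $0$ or to $\infty$, then $$m(t_1\cdot P_1\text{ AND }\dotsb\text{ AND }t_n\cdot P_n)\ \to\ \prod_{i=1}^n m(P_i).$$ -/

import Mathlib

open Filter Topology MeasureTheory
open scoped NNReal ENNReal Pointwise

namespace Supersaturation

/-- A property of (Lebesgue measurable) subsets of `ℝ^d`. All definitions below evaluate a property
only at Lebesgue measurable sets, i.e. at sets `A` with `NullMeasurableSet A volume`; its values at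
other sets play no role. -/
abbrev SetProperty (d : ℕ) : Type := Set (EuclideanSpace ℝ (Fin d)) → Prop

/-- `Q(x, r)`: the open axis-parallel cube of side length `r` centred at `x`. -/
def cube {d : ℕ} (x : EuclideanSpace ℝ (Fin d)) (r : ℝ) : Set (EuclideanSpace ℝ (Fin d)) :=
  {y | ∀ i, |y i - x i| < r / 2}

/-- `d_Ω(A) = |A ∩ Ω| / |Ω|`. -/
noncomputable def density {d : ℕ} (Ω A : Set (EuclideanSpace ℝ (Fin d))) : ℝ≥0∞ :=
  volume (A ∩ Ω) / volume Ω

/-- The upper limit density `limsup_{R → ∞} d_{Q(0,R)}(A)`. -/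
noncomputable def upperDensity {d : ℕ} (A : Set (EuclideanSpace ℝ (Fin d))) : ℝ≥0∞ :=
  limsup (fun R : ℝ => density (cube 0 R) A) atTop

/-- `m(P)`: the supremum of the upper densities of the measurable sets with property `P`. -/
noncomputable def maxDensity {d : ℕ} (P : SetProperty d) : ℝ≥0∞ :=
  ⨆ (A : Set (EuclideanSpace ℝ (Fin d))) (_ : NullMeasurableSet A volume) (_ : P A),
    upperDensity A

/-- `t · P` holds for `A` when `P` holds for `(1/t) · A`. -/
def dilate {d : ℕ} (t : ℝ) (P : SetProperty d) : SetProperty d := fun A => P (t⁻¹ • A)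

/-- `P₁ AND ⋯ AND Pₙ`. -/
def conj {d n : ℕ} (P : Fin n → SetProperty d) : SetProperty d := fun A => ∀ i, P i A

/-- The zooming-out operator `𝒵_δ(ε) A = {x : |Q(x,δ) ∩ A| > ε |Q(x,δ)|}`. -/
def zoomOut {d : ℕ} (δ ε : ℝ) (A : Set (EuclideanSpace ℝ (Fin d))) :
    Set (EuclideanSpace ℝ (Fin d)) :=
  {x | ε * volume.real (cube x δ) < volume.real (cube x δ ∩ A)}

/-- `A` and `B` are at distance at least `D` from each other. -/
def AtDistance {d : ℕ} (D : ℝ) (A B : Set (EuclideanSpace ℝ (Fin d))) : Prop :=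
  ∀ x ∈ A, ∀ y ∈ B, D ≤ dist x y

/-- `I` is a saturation function for the property `P`. -/
structure IsSaturationFunction {d : ℕ} (P : SetProperty d)
    (I : Set (EuclideanSpace ℝ (Fin d)) → ℝ≥0∞) : Prop where
  nontriviality : 0 < maxDensity P
  monotone : ∀ A B, NullMeasurableSet A volume → NullMeasurableSet B volume → B ⊆ A →
    I B ≤ I A ∧ (P A → P B)
  positivity : ∀ A, NullMeasurableSet A volume → 0 < I A → ¬ P A
  translation : ∀ A, NullMeasurableSet A volume → ∀ x : EuclideanSpace ℝ (Fin d),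
    (P (x +ᵥ A) ↔ P A) ∧ I (x +ᵥ A) = I A
  /-- The number `D` is `diam P`. The second part speaks about sequences of sets; finite families
  are the case where all but finitely many of the sets are empty. -/
  locality : ∃ D : ℝ,
    (∀ A₁ A₂, NullMeasurableSet A₁ volume → NullMeasurableSet A₂ volume → AtDistance D A₁ A₂ →
      I A₁ + I A₂ ≤ I (A₁ ∪ A₂)) ∧
    (∀ A : ℕ → Set (EuclideanSpace ℝ (Fin d)), (∀ k, NullMeasurableSet (A k) volume) →
      (∀ k l, k ≠ l → AtDistance D (A k) (A l)) → (P (⋃ k, A k) ↔ ∀ k, P (A k)))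
  zoomability : ∃ ε : ℝ, 0 < ε ∧ ∃ f : ℝ → ℝ≥0, (∀ δ, 0 < δ → 0 < f δ) ∧
    ∀ δ, 0 < δ → ∀ A, NullMeasurableSet A volume → ¬ P (zoomOut δ (1 - ε) A) → (f δ : ℝ≥0∞) ≤ I A
  /-- `I(A) ≥ g(ε) I(𝒵_δ(ε) A) - h(ε, δ) R^d` for `A ⊆ Q(0, R)`. -/
  zoomingOut : ∃ (g : ℝ → ℝ≥0) (h : ℝ → ℝ → ℝ≥0), (∀ ε, 0 < ε → 0 < g ε) ∧
    (∀ ε, 0 < ε → Tendsto (h ε) (𝓝[>] 0) (𝓝 0)) ∧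
    ∀ ε δ R : ℝ, 0 < ε → 0 < δ → 0 < R → ∀ A, NullMeasurableSet A volume → A ⊆ cube 0 R →
      (g ε : ℝ≥0∞) * I (zoomOut δ ε A) ≤ I A + (h ε δ : ℝ≥0∞) * ENNReal.ofReal R ^ d

/-- A property is supersaturable if it has a saturation function. -/
def Supersaturable {d : ℕ} (P : SetProperty d) : Prop :=
  ∃ I : Set (EuclideanSpace ℝ (Fin d)) → ℝ≥0∞, IsSaturationFunction P I

end Supersaturation

/-! Lower bound. Let `A` have `P` and upper density above `c`. Averaging over translates, some
translate of `A` covers at least the proportion `c` of any given bounded set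
(`exists_subset_of_lt_maxDensity`). Doing this for each property in turn, inside the set already
found, gives a subset of a large cube that has all the properties and nearly the product density. By
locality it can be repeated periodically with gaps `D`, negligible for a large cube
(`IsLocal.volume_real_le`).

Upper bound. Let `A` satisfy `P` and also `Q`, a property living on much smaller scales. By the
tiling bound for `Q`, every cell of moderate side has `A`-density at most about `m(Q)`. It remains
to show that, up to small loss, `A` lives in cells filling at most a proportion about `m(P)` of a
large cube (`exists_scales`). Let `U k` be the union of the cells of side `δ k` where `A` has
density above a threshold `e k`. As `A` has `P`, zooming out makes the saturation of `U (k+1)` as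
small as desired once `δ (k+1)` is small in terms of `δ k` (`exists_fine_scale`); zoomability then
gives `P` for the set of points around which `U (k+1)` nearly fills a cube of side comparable to `δ
k`. This set contains most of `U k` provided `U k \ U (k+1)` is small. Rapidly growing thresholds
make the `U k` almost decreasing, so by pigeonhole this happens for some `k` below a bound `K`
independent of `A`.

Since only finitely many scales occur, the required separation of `P` and `Q` is a fixed ratio
(`exists_scale_separation`). Induction, splitting off the property with the dominating `t i`,
finishes the proof (`eventually_maxDensity_lt`). -/

namespace Supersaturation

/-! ### Cubes, nested grids and their volumes -/

section Geometry

variable {d : ℕ}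

/-- The integer vector of the cell of side `δ` that contains `x`. -/
noncomputable def gridIndex (δ : ℝ) (x : EuclideanSpace ℝ (Fin d)) : Fin d → ℤ :=
  fun i => ⌊x i / δ⌋

/-- The half-open cell containing `x` of the grid of cubes of side length `δ`. -/
def cell (δ : ℝ) (x : EuclideanSpace ℝ (Fin d)) : Set (EuclideanSpace ℝ (Fin d)) :=
  {y | gridIndex δ y = gridIndex δ x}

theorem cube_eq_preimage (x : EuclideanSpace ℝ (Fin d)) (r : ℝ) :
    cube x r = (MeasurableEquiv.toLp 2 (Fin d → ℝ)).symm ⁻¹'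
      Set.univ.pi fun i => Set.Ioo (x i - r / 2) (x i + r / 2) := by
  ext y
  simp only [cube, Set.mem_ofPred_eq, Set.mem_preimage, Set.mem_univ_pi, Set.mem_Ioo, abs_lt]
  refine forall_congr' fun i => ?_
  change _ ↔ x i - r / 2 < y i ∧ y i < x i + r / 2
  constructor <;> rintro ⟨h, h'⟩ <;> constructor <;> linarith

theorem cell_eq_preimage {δ : ℝ} (hδ : 0 < δ) (x : EuclideanSpace ℝ (Fin d)) :
    cell δ x = (MeasurableEquiv.toLp 2 (Fin d → ℝ)).symm ⁻¹'
      Set.univ.pi fun i => Set.Ico (gridIndex δ x i * δ) ((gridIndex δ x i + 1) * δ) := by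
  ext y
  simp only [cell, Set.mem_ofPred_eq, Set.mem_preimage, Set.mem_univ_pi, Set.mem_Ico,
    funext_iff]
  refine forall_congr' fun i => ?_
  change _ ↔ _ ≤ y i ∧ y i < _
  rw [show gridIndex δ y i = ⌊y i / δ⌋ from rfl, Int.floor_eq_iff, le_div_iff₀ hδ, div_lt_iff₀ hδ]

theorem mem_cell_iff {δ : ℝ} (hδ : 0 < δ) {x y : EuclideanSpace ℝ (Fin d)} :
    y ∈ cell δ x ↔ ∀ i, gridIndex δ x i * δ ≤ y i ∧ y i < (gridIndex δ x i + 1) * δ := by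
  rw [cell_eq_preimage hδ]
  simp only [Set.mem_preimage, Set.mem_univ_pi, Set.mem_Ico]
  rfl

theorem self_mem_cell (δ : ℝ) (x : EuclideanSpace ℝ (Fin d)) : x ∈ cell δ x := rfl

theorem cell_eq_of_mem {δ : ℝ} {x y : EuclideanSpace ℝ (Fin d)} (h : y ∈ cell δ x) :
    cell δ y = cell δ x := by
  ext z
  simp only [cell, Set.mem_ofPred_eq] at h ⊢
  rw [h]

theorem measurableSet_cube (x : EuclideanSpace ℝ (Fin d)) (r : ℝ) : MeasurableSet (cube x r) := by
  rw [cube_eq_preimage]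
  exact (MeasurableEquiv.measurable _) (MeasurableSet.univ_pi fun _ => measurableSet_Ioo)

theorem measurableSet_cell {δ : ℝ} (hδ : 0 < δ) (x : EuclideanSpace ℝ (Fin d)) :
    MeasurableSet (cell δ x) := by
  rw [cell_eq_preimage hδ]
  exact (MeasurableEquiv.measurable _) (MeasurableSet.univ_pi fun _ => measurableSet_Ico)

theorem volume_cube (x : EuclideanSpace ℝ (Fin d)) {r : ℝ} (hr : 0 ≤ r) :
    volume (cube x r) = ENNReal.ofReal (r ^ d) := by
  rw [cube_eq_preimage, (EuclideanSpace.volume_preserving_symm_measurableEquiv_toLp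
    (Fin d)).measure_preimage_equiv, Real.volume_pi_Ioo]
  simp only [add_sub_sub_cancel, add_halves, Finset.prod_const, Finset.card_univ, Fintype.card_fin]
  rw [ENNReal.ofReal_pow hr]

theorem volume_cell {δ : ℝ} (hδ : 0 < δ) (x : EuclideanSpace ℝ (Fin d)) :
    volume (cell δ x) = ENNReal.ofReal (δ ^ d) := by
  rw [cell_eq_preimage hδ, (EuclideanSpace.volume_preserving_symm_measurableEquiv_toLp
    (Fin d)).measure_preimage_equiv, Real.volume_pi_Ico]
  have : ∀ i, (gridIndex δ x i + 1 : ℝ) * δ - gridIndex δ x i * δ = δ := fun i => by ring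
  simp only [this, Finset.prod_const, Finset.card_univ, Fintype.card_fin]
  rw [ENNReal.ofReal_pow hδ.le]

theorem volume_real_cube (x : EuclideanSpace ℝ (Fin d)) {r : ℝ} (hr : 0 ≤ r) :
    volume.real (cube x r) = r ^ d := by
  rw [Measure.real, volume_cube x hr, ENNReal.toReal_ofReal (by positivity)]

theorem volume_real_cell {δ : ℝ} (hδ : 0 < δ) (x : EuclideanSpace ℝ (Fin d)) :
    volume.real (cell δ x) = δ ^ d := by
  rw [Measure.real, volume_cell hδ x, ENNReal.toReal_ofReal (by positivity)]

theorem volume_cube_ne_top (x : EuclideanSpace ℝ (Fin d)) (r : ℝ) : volume (cube x r) ≠ ∞ := by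
  rcases le_or_gt 0 r with hr | hr
  · simp [volume_cube x hr]
  · refine ((measure_mono (t := cube x 0) fun y hy i => ?_).trans_lt ?_).ne
    · have := hy i; linarith
    · simp [volume_cube x le_rfl]

theorem volume_cell_ne_top {δ : ℝ} (hδ : 0 < δ) (x : EuclideanSpace ℝ (Fin d)) :
    volume (cell δ x) ≠ ∞ := by simp [volume_cell hδ]

theorem mem_cube_comm {x y : EuclideanSpace ℝ (Fin d)} {r : ℝ} : y ∈ cube x r ↔ x ∈ cube y r := by
  simp only [cube, Set.mem_ofPred_eq, abs_sub_comm]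

theorem cell_subset_cube {δ : ℝ} (hδ : 0 < δ) (x : EuclideanSpace ℝ (Fin d)) :
    cell δ x ⊆ cube x (2 * δ) := by
  intro y hy i
  have h1 := (mem_cell_iff hδ).1 hy i
  have h2 := (mem_cell_iff hδ).1 (self_mem_cell δ x) i
  rw [abs_lt]
  constructor <;> nlinarith

theorem cell_zero_subset_cube {δ : ℝ} (hδ : 0 < δ) :
    cell δ (0 : EuclideanSpace ℝ (Fin d)) ⊆ cube 0 (2 * δ) := cell_subset_cube hδ 0

theorem measurable_gridIndex (δ : ℝ) : Measurable (gridIndex (d := d) δ) := by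
  refine measurable_pi_lambda _ fun i => ?_
  refine Int.measurable_floor.comp ?_
  have : Measurable fun x : EuclideanSpace ℝ (Fin d) => x i := by fun_prop
  exact this.div_const δ

/-- Nesting comes from `⌊x / q⌋ = ⌊⌊x⌋ / q⌋` for a natural number `q`; this is why scales are always
refined by integer factors. -/
theorem cell_div_subset_cell {δ : ℝ} {q : ℕ} (hq : 0 < q) (x : EuclideanSpace ℝ (Fin d)) :
    cell (δ / q) x ⊆ cell δ x := by
  have key : ∀ z : EuclideanSpace ℝ (Fin d), ∀ i,
      gridIndex δ z i = gridIndex (δ / q) z i / (q : ℤ) := by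
    intro z i
    simp only [gridIndex]
    rw [← Int.floor_div_natCast]
    congr 1
    have : (q : ℝ) ≠ 0 := by positivity
    rcases eq_or_ne δ 0 with rfl | h
    · simp
    · field_simp
  intro y hy
  funext i
  rw [key, key, show gridIndex (δ / q) y = gridIndex (δ / q) x from hy]

/-- Comparison of volumes cell by cell. -/
theorem volume_le_of_forall_cell {δ : ℝ} {a : ℝ≥0∞} {E F : Set (EuclideanSpace ℝ (Fin d))}
    (h : ∀ x, volume (E ∩ cell δ x) ≤ a * volume (F ∩ cell δ x)) : volume E ≤ a * volume F := by
  have key : ∀ G : Set (EuclideanSpace ℝ (Fin d)),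
      volume G = ∑' v : (Set.univ : Set (Fin d → ℤ)), volume (G ∩ gridIndex δ ⁻¹' {v.1}) := by
    intro G
    have := tsum_measure_preimage_singleton (μ := volume.restrict G) Set.countable_univ
      (f := gridIndex (d := d) δ) fun y _ => measurable_gridIndex δ (measurableSet_singleton y)
    rw [Set.preimage_univ, Measure.restrict_apply_univ] at this
    rw [← this]
    refine tsum_congr fun v => ?_
    rw [Measure.restrict_apply (measurable_gridIndex δ (measurableSet_singleton _)), Set.inter_comm]
  rw [key E, key F, ← ENNReal.tsum_mul_left]
  refine ENNReal.tsum_le_tsum fun v => ?_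
  by_cases hv : ∃ x, gridIndex δ x = v.1
  · obtain ⟨x, hx⟩ := hv
    have : gridIndex δ ⁻¹' {v.1} = cell δ x := by
      ext y
      simp [cell, hx]
    rw [this]
    exact h x
  · have : gridIndex (d := d) δ ⁻¹' {v.1} = ∅ := by
      ext y
      simp only [Set.mem_preimage, Set.mem_singleton_iff, Set.mem_empty_iff_false, iff_false]
      exact fun hy => hv ⟨y, hy⟩
    simp [this]

theorem volume_real_le_of_forall_cell {δ a : ℝ} (hδ : 0 < δ) (ha : 0 ≤ a)
    {E F : Set (EuclideanSpace ℝ (Fin d))} (hF : volume F ≠ ∞)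
    (h : ∀ x, volume.real (E ∩ cell δ x) ≤ a * volume.real (F ∩ cell δ x)) :
    volume.real E ≤ a * volume.real F := by
  have := volume_le_of_forall_cell (δ := δ) (a := ENNReal.ofReal a) (E := E) (F := F) fun x => by
    have hE : volume (E ∩ cell δ x) ≠ ∞ :=
      measure_ne_top_of_subset Set.inter_subset_right (volume_cell_ne_top hδ x)
    have hF : volume (F ∩ cell δ x) ≠ ∞ :=
      measure_ne_top_of_subset Set.inter_subset_right (volume_cell_ne_top hδ x)
    rw [← ENNReal.ofReal_toReal hE, ← ENNReal.ofReal_toReal hF, ← ENNReal.ofReal_mul ha]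
    exact ENNReal.ofReal_le_ofReal (h x)
  rw [Measure.real, Measure.real, ← ENNReal.toReal_ofReal ha, ← ENNReal.toReal_mul]
  exact ENNReal.toReal_mono (ENNReal.mul_ne_top ENNReal.ofReal_ne_top hF) this

theorem measurableSet_setOf_mem_cube (ρ : ℝ) :
    MeasurableSet {p : EuclideanSpace ℝ (Fin d) × EuclideanSpace ℝ (Fin d) |
      p.2 ∈ cube p.1 ρ} := by
  have : {p : EuclideanSpace ℝ (Fin d) × EuclideanSpace ℝ (Fin d) | p.2 ∈ cube p.1 ρ}
      = ⋂ i, {p | |p.2 i - p.1 i| < ρ / 2} := by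
    ext p; simp [cube]
  rw [this]
  refine MeasurableSet.iInter fun i => (isOpen_lt ?_ continuous_const).measurableSet
  fun_prop

theorem measurable_volume_cube_inter (ρ : ℝ) {E : Set (EuclideanSpace ℝ (Fin d))}
    (hE : NullMeasurableSet E volume) : Measurable fun x => volume (cube x ρ ∩ E) := by
  obtain ⟨E', -, hE', hEE⟩ := hE.exists_measurable_subset_ae_eq
  have h1 : ∀ x, volume (cube x ρ ∩ E) = volume (cube x ρ ∩ E') := fun x =>
    measure_congr ((ae_eq_refl _).inter hEE.symm)
  simp_rw [h1]
  exact measurable_measure_prodMk_left (ν := volume)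
    ((measurableSet_setOf_mem_cube (d := d) ρ).inter (measurable_snd hE'))

theorem measurableSet_zoomOut (δ ε : ℝ) {A : Set (EuclideanSpace ℝ (Fin d))}
    (hA : NullMeasurableSet A volume) : MeasurableSet (zoomOut δ ε A) := by
  have h1 : Measurable fun x : EuclideanSpace ℝ (Fin d) => volume.real (cube x δ) := by
    have := (measurable_volume_cube_inter (d := d) δ (nullMeasurableSet_univ)).ennreal_toReal
    simpa [Measure.real] using this
  exact measurableSet_lt (h1.const_mul ε) (measurable_volume_cube_inter δ hA).ennreal_toReal

/-- Points around which a set has a given proportion of a cube are few. -/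
theorem volume_setOf_le_cube_inter {ρ ε : ℝ} (hρ : 0 < ρ) (hε : 0 < ε)
    {E : Set (EuclideanSpace ℝ (Fin d))} (hE : MeasurableSet E) (hE' : volume E ≠ ∞) :
    volume {x | ε * ρ ^ d ≤ volume.real (cube x ρ ∩ E)} ≠ ∞ ∧
    volume.real {x | ε * ρ ^ d ≤ volume.real (cube x ρ ∩ E)} ≤ volume.real E / ε := by
  have hm := measurable_volume_cube_inter (d := d) ρ hE.nullMeasurableSet
  -- Tonelli: each point of `E` lies in the cubes around a set of centres of volume `ρ ^ d`.
  -- Markov's inequality then gives the claim.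
  have hint : ∫⁻ x, volume (cube x ρ ∩ E) = ENNReal.ofReal (ρ ^ d) * volume E := by
    have hs : MeasurableSet {p : EuclideanSpace ℝ (Fin d) × EuclideanSpace ℝ (Fin d) |
      p.2 ∈ cube p.1 ρ ∩ E} := (measurableSet_setOf_mem_cube ρ).inter (measurable_snd hE)
    have e1 := Measure.prod_apply (μ := volume) (ν := volume) hs
    have e2 := Measure.prod_apply_symm (μ := volume) (ν := volume) hs
    have e3 : ∫⁻ x, volume (cube x ρ ∩ E) = ∫⁻ y, volume
        ((fun x => (x, y)) ⁻¹' {p : EuclideanSpace ℝ (Fin d) × EuclideanSpace ℝ (Fin d) |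
          p.2 ∈ cube p.1 ρ ∩ E}) := by
      rw [← e2, e1]; rfl
    rw [e3]
    have e4 : ∀ y, volume ((fun x => (x, y)) ⁻¹' {p : EuclideanSpace ℝ (Fin d) ×
        EuclideanSpace ℝ (Fin d) | p.2 ∈ cube p.1 ρ ∩ E})
        = E.indicator (fun _ => ENNReal.ofReal (ρ ^ d)) y := by
      intro y
      by_cases hy : y ∈ E
      · rw [Set.indicator_of_mem hy, ← volume_cube y hρ.le]
        congr 1
        ext x
        simp [hy, mem_cube_comm (x := x)]
      · rw [Set.indicator_of_notMem hy]
        simp [hy]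
    simp_rw [e4]
    rw [lintegral_indicator_const hE]
  have hpos : 0 < ε * ρ ^ d := by positivity
  have hset : {x | ε * ρ ^ d ≤ volume.real (cube x ρ ∩ E)}
      = {x : EuclideanSpace ℝ (Fin d) | ENNReal.ofReal (ε * ρ ^ d) ≤ volume (cube x ρ ∩ E)} := by
    ext x
    simp only [Set.mem_ofPred_eq]
    rw [ENNReal.ofReal_le_iff_le_toReal
      (measure_ne_top_of_subset Set.inter_subset_left (volume_cube_ne_top x ρ))]
    rfl
  have hle : volume {x | ε * ρ ^ d ≤ volume.real (cube x ρ ∩ E)}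
      ≤ ENNReal.ofReal (volume.real E / ε) := by
    rw [hset]
    refine (meas_ge_le_lintegral_div hm.aemeasurable (by simpa using hpos)
      ENNReal.ofReal_ne_top).trans ?_
    rw [hint, ← ENNReal.ofReal_toReal hE', ← ENNReal.ofReal_mul (by positivity),
      ← ENNReal.ofReal_div_of_pos hpos]
    refine ENNReal.ofReal_le_ofReal (le_of_eq ?_)
    have : ρ ^ d ≠ 0 := by positivity
    rw [Measure.real]
    field_simp
  refine ⟨(hle.trans_lt ENNReal.ofReal_lt_top).ne, ?_⟩
  rw [Measure.real]
  exact ENNReal.toReal_le_of_le_ofReal (by positivity) hle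

end Geometry

/-! ### Averaging over translates and periodic tiling -/

section Density

variable {d : ℕ}

/-- Monotone translation-invariant properties that can be checked separately on the parts of a
set at mutual distance at least `D`. -/
structure IsLocal (P : SetProperty d) (D : ℝ) : Prop where
  nonneg : 0 ≤ D
  mono : ∀ A B, NullMeasurableSet A volume → NullMeasurableSet B volume → B ⊆ A → P A → P B
  vadd : ∀ A, NullMeasurableSet A volume → ∀ x : EuclideanSpace ℝ (Fin d), P (x +ᵥ A) ↔ P A
  iUnion : ∀ A : ℕ → Set (EuclideanSpace ℝ (Fin d)), (∀ k, NullMeasurableSet (A k) volume) →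
    (∀ k l, k ≠ l → AtDistance D (A k) (A l)) → (P (⋃ k, A k) ↔ ∀ k, P (A k))

theorem density_le_one (Ω A : Set (EuclideanSpace ℝ (Fin d))) : density Ω A ≤ 1 := by
  refine ENNReal.div_le_of_le_mul ?_
  rw [one_mul]
  exact measure_mono Set.inter_subset_right

theorem upperDensity_le_one (A : Set (EuclideanSpace ℝ (Fin d))) : upperDensity A ≤ 1 := by
  refine limsup_le_of_le (by isBoundedDefault) (Eventually.of_forall fun R => density_le_one _ _)

theorem maxDensity_le_one (P : SetProperty d) : maxDensity P ≤ 1 :=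
  iSup_le fun A => iSup_le fun _ => iSup_le fun _ => upperDensity_le_one A

theorem maxDensity_ne_top (P : SetProperty d) : maxDensity P ≠ ∞ :=
  ((maxDensity_le_one P).trans_lt ENNReal.one_lt_top).ne

theorem toReal_maxDensity_le_one (P : SetProperty d) : (maxDensity P).toReal ≤ 1 :=
  ENNReal.toReal_le_of_le_ofReal zero_le_one (by simpa using maxDensity_le_one P)

theorem ofReal_lt_density_cube {c R : ℝ} (hc : 0 ≤ c) (hR : 0 < R)
    {A : Set (EuclideanSpace ℝ (Fin d))} :
    ENNReal.ofReal c < density (cube 0 R) A ↔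
      ENNReal.ofReal (c * R ^ d) < volume (A ∩ cube 0 R) := by
  rw [density, volume_cube 0 hR.le, ENNReal.ofReal_mul hc]
  rw [ENNReal.lt_div_iff_mul_lt (by left; simp; positivity) (by left; simp)]

theorem ofReal_le_density_cube {c R : ℝ} (hc : 0 ≤ c) (hR : 0 < R)
    {A : Set (EuclideanSpace ℝ (Fin d))} :
    ENNReal.ofReal c ≤ density (cube 0 R) A ↔
      ENNReal.ofReal (c * R ^ d) ≤ volume (A ∩ cube 0 R) := by
  rw [density, volume_cube 0 hR.le, ENNReal.ofReal_mul hc]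
  rw [ENNReal.le_div_iff_mul_le (by left; simp; positivity) (by left; simp)]

/-- Integrating the volumes of the intersections of `S` with the translates of `A`. -/
theorem volume_mul_volume_le_lintegral {A S : Set (EuclideanSpace ℝ (Fin d))}
    (hA : MeasurableSet A) (hS : MeasurableSet S) {r N : ℝ} (hSr : S ⊆ cube 0 r) :
    volume S * volume (A ∩ cube 0 N) ≤ ∫⁻ x : EuclideanSpace ℝ (Fin d) in cube 0 (N + r), volume (S ∩ (x +ᵥ A)) := by
  set T : Set (EuclideanSpace ℝ (Fin d) × EuclideanSpace ℝ (Fin d)) :=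
    {p | p.2 ∈ S ∧ p.2 - p.1 ∈ A} with hT
  have hTm : MeasurableSet T :=
    (measurable_snd hS).inter ((measurable_snd.sub measurable_fst) hA)
  have e1 := Measure.prod_apply (μ := volume.restrict (cube 0 (N + r))) (ν := volume) hTm
  have e2 := Measure.prod_apply_symm (μ := volume.restrict (cube 0 (N + r))) (ν := volume) hTm
  have e3 : ∀ x, Prod.mk x ⁻¹' T = S ∩ (x +ᵥ A) := by
    intro x
    ext y
    simp only [hT, Set.mem_preimage, Set.mem_ofPred_eq, Set.mem_inter_iff,
      Set.mem_vadd_set_iff_neg_vadd_mem, vadd_eq_add, neg_add_eq_sub]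
  simp_rw [e3] at e1
  rw [← e1, e2, mul_comm, ← lintegral_indicator_const hS]
  refine lintegral_mono fun s => ?_
  by_cases hs : s ∈ S
  · rw [Set.indicator_of_mem hs]
    have hpre : volume ((fun x => s - x) ⁻¹' (A ∩ cube 0 N)) = volume (A ∩ cube 0 N) :=
      (Measure.measurePreserving_sub_left volume s).measure_preimage
        (hA.inter (measurableSet_cube _ _)).nullMeasurableSet
    rw [← hpre, Measure.restrict_apply' (measurableSet_cube _ _)]
    refine measure_mono fun x hx => ⟨⟨hs, hx.1⟩, fun i => ?_⟩
    have h1 := hx.2 i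
    have h2 := hSr hs i
    simp only [PiLp.zero_apply, PiLp.sub_apply, sub_zero, abs_lt] at h1 h2 ⊢
    constructor <;> linarith
  · rw [Set.indicator_of_notMem hs]
    exact bot_le

/-- Any bounded set contains a set with property `P` of relative measure close to `m(P)`. -/
theorem exists_subset_of_lt_maxDensity {P : SetProperty d}
    (hmono : ∀ A B, NullMeasurableSet A volume → NullMeasurableSet B volume → B ⊆ A → P A → P B)
    (hvadd : ∀ A, NullMeasurableSet A volume → ∀ x : EuclideanSpace ℝ (Fin d),
      P (x +ᵥ A) ↔ P A)
    {c : ℝ} (hc0 : 0 ≤ c) (hc : c < (maxDensity P).toReal) {S : Set (EuclideanSpace ℝ (Fin d))}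
    (hS : MeasurableSet S) {r : ℝ} (hSr : S ⊆ cube 0 r) :
    ∃ B ⊆ S, MeasurableSet B ∧ P B ∧ c * volume.real S ≤ volume.real B := by
  have hc' : ENNReal.ofReal c < maxDensity P :=
    (ENNReal.ofReal_lt_iff_lt_toReal hc0 (maxDensity_ne_top P)).2 hc
  simp only [maxDensity, lt_iSup_iff] at hc'
  obtain ⟨A₀, hA₀, hPA₀, hlt⟩ := hc'
  -- A measurable subset of full measure keeps `P` by monotonicity and has the same upper density.
  obtain ⟨A, hAA₀, hA, hae⟩ := hA₀.exists_measurable_subset_ae_eq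
  have hPA : P A := hmono _ _ hA₀ hA.nullMeasurableSet hAA₀ hPA₀
  have hup : upperDensity A = upperDensity A₀ := by
    simp only [upperDensity, density]
    congr 1
    ext R
    have h : volume (A ∩ cube 0 R) = volume (A₀ ∩ cube 0 R) :=
      measure_congr (hae.inter (ae_eq_refl _))
    rw [h]
  rw [← hup] at hlt
  have hgood : ∀ x : EuclideanSpace ℝ (Fin d), S ∩ (x +ᵥ A) ⊆ S ∧ MeasurableSet (S ∩ (x +ᵥ A)) ∧
      P (S ∩ (x +ᵥ A)) := fun x => by
    have hm : MeasurableSet (x +ᵥ A) := hA.const_vadd x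
    exact ⟨Set.inter_subset_left, hS.inter hm, hmono _ _ hm.nullMeasurableSet
      (hS.inter hm).nullMeasurableSet Set.inter_subset_right
      ((hvadd A hA.nullMeasurableSet x).2 hPA)⟩
  have hSfin : volume S ≠ ∞ := measure_ne_top_of_subset hSr (volume_cube_ne_top _ _)
  suffices h : ∃ x : EuclideanSpace ℝ (Fin d),
      c * volume.real S ≤ volume.real (S ∩ (x +ᵥ A)) by
    obtain ⟨x, hx⟩ := h
    exact ⟨_, (hgood x).1, (hgood x).2.1, (hgood x).2.2, hx⟩
  -- If every translate met `S` in less than `c |S|`, integrating over the cube of side `N + |r|`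
  -- would contradict the density of `A` in the cube of side `N`, for a suitable large `N`.
  by_contra! hcon
  have hSpos : 0 < volume.real S := by
    refine lt_of_le_of_ne measureReal_nonneg fun h => ?_
    have := hcon 0
    rw [← h, mul_zero] at this
    exact absurd this (not_lt.2 measureReal_nonneg)
  obtain ⟨c', hcc', hc'⟩ := ENNReal.lt_iff_exists_nnreal_btwn.1 hlt
  rw [ENNReal.ofReal_lt_coe_iff hc0] at hcc'
  have hfreq : ∃ᶠ R : ℝ in atTop, (c' : ℝ≥0∞) < density (cube 0 R) A :=
    frequently_lt_of_lt_limsup (by isBoundedDefault) hc'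
  have hlim : Tendsto (fun N : ℝ => c * (1 + |r| / N) ^ d) atTop (𝓝 (c * (1 + 0) ^ d)) :=
    ((tendsto_const_nhds.add (tendsto_const_nhds.div_atTop tendsto_id)).pow d).const_mul c
  rw [add_zero, one_pow, mul_one] at hlim
  obtain ⟨N, hN, hlt', hN0⟩ :=
    (hfreq.and_eventually ((hlim.eventually_lt_const hcc').and (eventually_gt_atTop 0))).exists
  have hN' : c * (N + |r|) ^ d < c' * N ^ d := by
    have : (N + |r|) ^ d = (1 + |r| / N) ^ d * N ^ d := by
      rw [← mul_pow]; congr 1; field_simp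
    rw [this, ← mul_assoc]
    exact mul_lt_mul_of_pos_right hlt' (by positivity)
  rw [← ENNReal.ofReal_coe_nnreal, ofReal_lt_density_cube c'.coe_nonneg hN0] at hN
  have hSr' : S ⊆ cube 0 |r| := hSr.trans fun y hy i => (hy i).trans_le (by
    linarith [le_abs_self r])
  have h1 := volume_mul_volume_le_lintegral (N := N) hA hS hSr'
  have h2 : ∫⁻ x : EuclideanSpace ℝ (Fin d) in cube 0 (N + |r|), volume (S ∩ (x +ᵥ A)) ≤
      ENNReal.ofReal (c * volume.real S) * ENNReal.ofReal ((N + |r|) ^ d) := by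
    rw [← volume_cube (0 : EuclideanSpace ℝ (Fin d)) (by positivity : 0 ≤ N + |r|),
      ← setLIntegral_const]
    refine lintegral_mono fun x => ?_
    rw [← ENNReal.ofReal_toReal (measure_ne_top_of_subset (hgood x).1 hSfin)]
    exact ENNReal.ofReal_le_ofReal (hcon x).le
  have h3 : ENNReal.ofReal (volume.real S) * ENNReal.ofReal (c' * N ^ d) ≤
      ENNReal.ofReal (c * volume.real S) * ENNReal.ofReal ((N + |r|) ^ d) := by
    refine le_trans ?_ (h1.trans h2)
    rw [Measure.real, ENNReal.ofReal_toReal hSfin]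
    gcongr
  rw [← ENNReal.ofReal_mul measureReal_nonneg, ← ENNReal.ofReal_mul (by positivity),
    ENNReal.ofReal_le_ofReal_iff (by positivity)] at h3
  have := mul_lt_mul_of_pos_left hN' hSpos
  linarith

theorem IsLocal.empty {P : SetProperty d} {D : ℝ} (hP : IsLocal P D)
    {A : Set (EuclideanSpace ℝ (Fin d))} (hA : NullMeasurableSet A volume) (h : P A) : P ∅ :=
  hP.mono A ∅ hA nullMeasurableSet_empty (Set.empty_subset _) h

theorem abs_apply_sub_le_dist (x y : EuclideanSpace ℝ (Fin d)) (i : Fin d) :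
    |x i - y i| ≤ dist x y := by
  rw [dist_eq_norm]
  exact PiLp.norm_apply_le (x - y) i

/-- The tiling bound: a set with property `P` that fits into a cube of side `T` can be repeated with
period `T + D`. -/
theorem IsLocal.volume_real_le {P : SetProperty d} {D : ℝ} (hP : IsLocal P D) {T : ℝ} (hT : 0 < T)
    {B : Set (EuclideanSpace ℝ (Fin d))} (hB : MeasurableSet B) (hPB : P B)
    {x : EuclideanSpace ℝ (Fin d)} (hBx : B ⊆ cell T x) :
    volume.real B ≤ (maxDensity P).toReal * (T + D) ^ d := by
  have hD := hP.nonneg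
  set S := T + D with hS
  have hS0 : 0 < S := by positivity
  have hBdiff : ∀ b ∈ B, ∀ b' ∈ B, ∀ i, |b i - b' i| < T := by
    intro b hb b' hb' i
    have h1 := (mem_cell_iff hT).1 (hBx hb) i
    have h2 := (mem_cell_iff hT).1 (hBx hb') i
    rw [abs_lt]
    constructor <;> linarith
  obtain ⟨r, hr0, hr⟩ : ∃ r : ℝ, 0 < r ∧ B ⊆ cube 0 r := by
    refine ⟨2 * (T + ‖x‖), by positivity, fun b hb i => ?_⟩
    have h1 := cell_subset_cube hT x (hBx hb) i
    have h2 : |x i| ≤ ‖x‖ := PiLp.norm_apply_le x i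
    simp only [PiLp.zero_apply, sub_zero]
    have h3 := abs_add_le (b i - x i) (x i)
    rw [sub_add_cancel] at h3
    linarith
  set τ : (Fin d → ℤ) → EuclideanSpace ℝ (Fin d) := fun v => WithLp.toLp 2 fun i => S * v i with hτ
  -- Coordinates of points of `B` differ by less than `T`, so distinct translates are more than `S -
  -- T = D` apart in some coordinate.
  have hsep : ∀ v w : Fin d → ℤ, v ≠ w → ∀ y ∈ τ v +ᵥ B, ∀ z ∈ τ w +ᵥ B, D < dist y z := by
    rintro v w hvw _ ⟨b, hb, rfl⟩ _ ⟨b', hb', rfl⟩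
    obtain ⟨i, hi⟩ := Function.ne_iff.1 hvw
    refine lt_of_lt_of_le ?_ (abs_apply_sub_le_dist _ _ i)
    have h1 : (1 : ℝ) ≤ |(v i : ℝ) - w i| := by
      have : 1 ≤ |v i - w i| := Int.one_le_abs (sub_ne_zero.2 hi)
      exact_mod_cast this
    have h2 := hBdiff b hb b' hb' i
    have h3 : (τ v +ᵥ b) i - (τ w +ᵥ b') i = S * (v i - w i) - (b' i - b i) := by
      simp only [hτ, vadd_eq_add, PiLp.add_apply]
      ring
    change D < |(τ v +ᵥ b) i - (τ w +ᵥ b') i|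
    rw [h3]
    have h4 := abs_sub_abs_le_abs_sub (S * ((v i : ℝ) - w i)) (b' i - b i)
    rw [abs_mul, abs_of_pos hS0, abs_sub_comm (b' i)] at h4
    nlinarith
  set C : Set (EuclideanSpace ℝ (Fin d)) := ⋃ v, τ v +ᵥ B with hC
  have hmB : ∀ v, MeasurableSet (τ v +ᵥ B) := fun v => hB.const_vadd _
  have hCm : MeasurableSet C := MeasurableSet.iUnion hmB
  have hPv : ∀ v, P (τ v +ᵥ B) := fun v => (hP.vadd B hB.nullMeasurableSet _).2 hPB
  have hPC : P C := by
    -- Reindexes the lattice by `ℕ`; numbers that encode no vector contribute `∅`, which has `P` by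
    -- monotonicity.
    rw [hC, ← Encodable.iUnion_decode₂]
    refine (hP.iUnion _ (fun k => ?_) fun k l hkl y hy z hz => ?_).2 fun k => ?_
    · exact Encodable.iUnion_decode₂_cases (C := fun A => NullMeasurableSet A volume)
        nullMeasurableSet_empty fun v => (hmB v).nullMeasurableSet
    · simp only [Set.mem_iUnion, Encodable.mem_decode₂] at hy hz
      obtain ⟨v, rfl, hy⟩ := hy
      obtain ⟨w, rfl, hz⟩ := hz
      exact (hsep v w (fun h => hkl (h ▸ rfl)) y hy z hz).le
    · exact Encodable.iUnion_decode₂_cases (C := P) (hP.empty hB.nullMeasurableSet hPB) hPv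
  have hBfin : volume B ≠ ∞ := measure_ne_top_of_subset hr (volume_cube_ne_top _ _)
  have hcount : ∀ k : ℕ, ENNReal.ofReal ((1 + 2 * k) ^ d * volume.real B) ≤
      volume (C ∩ cube 0 (r + 2 * S * k)) := by
    intro k
    set V : Finset (Fin d → ℤ) := Fintype.piFinset fun _ => Finset.Icc (-k : ℤ) k with hV
    have hcard : (V.card : ℝ) = (1 + 2 * k) ^ d := by
      rw [hV, Fintype.card_piFinset_const, Int.card_Icc]
      have : ((k : ℤ) + 1 - -k).toNat = 1 + 2 * k := by omega
      rw [this]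
      push_cast
      ring
    have hsub : (⋃ v ∈ V, τ v +ᵥ B) ⊆ C ∩ cube 0 (r + 2 * S * k) := by
      intro y hy
      simp only [Set.mem_iUnion] at hy
      obtain ⟨v, hv, hy⟩ := hy
      refine ⟨Set.mem_iUnion.2 ⟨v, hy⟩, fun i => ?_⟩
      obtain ⟨b, hb, rfl⟩ := hy
      have h1 := hr hb i
      have h2 := Finset.mem_Icc.1 (Fintype.mem_piFinset.1 hv i)
      have h3 : -(k : ℝ) ≤ v i := by exact_mod_cast h2.1
      have h4 : (v i : ℝ) ≤ k := by exact_mod_cast h2.2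
      simp only [PiLp.zero_apply, sub_zero, hτ, vadd_eq_add, PiLp.add_apply, abs_lt] at h1 ⊢
      constructor <;> nlinarith
    refine le_trans (le_of_eq ?_) (measure_mono hsub)
    rw [measure_biUnion_finset _ fun v _ => hmB v]
    · simp only [measure_vadd, Finset.sum_const, nsmul_eq_mul]
      rw [ENNReal.ofReal_mul (by positivity), ← hcard, ENNReal.ofReal_natCast, Measure.real,
        ENNReal.ofReal_toReal hBfin]
    · intro v _ w _ hvw
      refine Set.disjoint_left.2 fun y hy hy' => ?_
      have := hsep v w hvw y hy y hy'
      rw [dist_self] at this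
      linarith
  rw [← div_le_iff₀ (by positivity)]
  refine le_of_forall_lt fun c hc => ?_
  rcases lt_or_ge c 0 with hc0 | hc0
  · exact hc0.trans_le ENNReal.toReal_nonneg
  obtain ⟨c', hcc', hc'⟩ := exists_between hc
  refine hcc'.trans_le ?_
  -- The cube of side `r + 2 S k` contains `(1 + 2 k) ^ d` translates, so the density of `C` in it
  -- is asymptotically at least `|B| / S ^ d`.
  have hlim := ((tendsto_add_mul_div_add_mul_atTop_nhds (1 : ℝ) r 2
    (by positivity : 2 * S ≠ 0)).pow d).mul_const (volume.real B)
  have hval : (2 / (2 * S)) ^ d * volume.real B = volume.real B / S ^ d := by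
    rw [mul_comm 2 S, ← div_div, div_right_comm, div_self two_ne_zero, one_div, inv_pow]
    field_simp
  rw [hval] at hlim
  have hR : Tendsto (fun k : ℕ => r + 2 * S * (k : ℝ)) atTop atTop :=
    tendsto_atTop_add_const_left _ _ (tendsto_natCast_atTop_atTop.const_mul_atTop (by positivity))
  have hfreq : ∃ᶠ R in atTop, ENNReal.ofReal c' ≤ density (cube 0 R) C := by
    refine hR.frequently (Eventually.frequently ?_)
    filter_upwards [hlim.eventually_const_lt hc'] with k hk
    have hpos : 0 < r + 2 * S * k := by positivity
    rw [ofReal_le_density_cube (hc0.trans hcc'.le) hpos]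
    refine le_trans (ENNReal.ofReal_le_ofReal ?_) (hcount k)
    rw [div_pow, div_mul_eq_mul_div, lt_div_iff₀ (by positivity)] at hk
    exact hk.le
  have hup : ENNReal.ofReal c' ≤ upperDensity C :=
    le_limsup_of_frequently_le hfreq (by isBoundedDefault)
  have hmax : upperDensity C ≤ maxDensity P :=
    le_iSup_of_le C (le_iSup_of_le hCm.nullMeasurableSet (le_iSup_of_le hPC le_rfl))
  exact (ENNReal.ofReal_le_iff_le_toReal (maxDensity_ne_top P)).1 (hup.trans hmax)

end Density

/-! ### Unions of dense cells -/

section DenseCells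

variable {d : ℕ}

/-- The union of the cells of side `δ` in which `A` has density greater than `e`. -/
def denseCells (δ e : ℝ) (A : Set (EuclideanSpace ℝ (Fin d))) : Set (EuclideanSpace ℝ (Fin d)) :=
  {x | e * δ ^ d < volume.real (A ∩ cell δ x)}

theorem mem_denseCells_iff_of_mem_cell {δ e : ℝ} {A : Set (EuclideanSpace ℝ (Fin d))}
    {x y : EuclideanSpace ℝ (Fin d)} (h : y ∈ cell δ x) :
    y ∈ denseCells δ e A ↔ x ∈ denseCells δ e A := by
  simp only [denseCells, Set.mem_ofPred_eq, cell_eq_of_mem h]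

theorem measurableSet_denseCells (δ e : ℝ) (A : Set (EuclideanSpace ℝ (Fin d))) :
    MeasurableSet (denseCells δ e A) := by
  have : denseCells δ e A = gridIndex δ ⁻¹' (gridIndex δ '' denseCells δ e A) := by
    refine (Set.subset_preimage_image _ _).antisymm ?_
    rintro y ⟨x, hx, hxy⟩
    exact (mem_denseCells_iff_of_mem_cell (hxy : gridIndex δ x = gridIndex δ y)).1 hx
  rw [this]
  exact measurable_gridIndex δ (Set.to_countable _).measurableSet

/-- The cube of side `2 * δ` around any point of a cell contains the cell and has `2 ^ d` times its
volume, hence the threshold `e / 2 ^ d`. -/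
theorem denseCells_subset_zoomOut {δ e : ℝ} (hδ : 0 < δ) (A : Set (EuclideanSpace ℝ (Fin d))) :
    denseCells δ e A ⊆ zoomOut (2 * δ) (e / 2 ^ d) A := by
  intro x hx
  have hx' : e * δ ^ d < volume.real (A ∩ cell δ x) := hx
  change e / 2 ^ d * volume.real (cube x (2 * δ)) < volume.real (cube x (2 * δ) ∩ A)
  rw [volume_real_cube x (by positivity), mul_pow, ← mul_assoc,
    div_mul_cancel₀ _ (by positivity : (2 : ℝ) ^ d ≠ 0)]
  refine hx'.trans_le (measureReal_mono ?_
    (measure_ne_top_of_subset Set.inter_subset_left (volume_cube_ne_top x _)))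
  exact fun y hy => ⟨cell_subset_cube hδ x hy.2, hy.1⟩

variable {L δ : ℝ}

theorem cell_subset_of_mem (hnest : ∀ x : EuclideanSpace ℝ (Fin d), cell δ x ⊆ cell L x)
    {x z : EuclideanSpace ℝ (Fin d)} (hx : x ∈ cell L z) : cell δ x ⊆ cell L z :=
  cell_eq_of_mem hx ▸ hnest x

theorem mem_of_inter_cell_nonempty (hnest : ∀ x : EuclideanSpace ℝ (Fin d), cell δ x ⊆ cell L x)
    {x z : EuclideanSpace ℝ (Fin d)} (h : (cell L z ∩ cell δ x).Nonempty) : x ∈ cell L z := by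
  obtain ⟨y, hy, hyx⟩ := h
  have : gridIndex L y = gridIndex L x := hnest x hyx
  change gridIndex L x = gridIndex L z
  rw [← this]
  exact hy

theorem denseCells_subset (hnest : ∀ x : EuclideanSpace ℝ (Fin d), cell δ x ⊆ cell L x)
    {e : ℝ} (hδ : 0 < δ) (he : 0 ≤ e) {A : Set (EuclideanSpace ℝ (Fin d))}
    {z : EuclideanSpace ℝ (Fin d)} (hA : A ⊆ cell L z) : denseCells δ e A ⊆ cell L z := by
  intro x hx
  have hx' : e * δ ^ d < volume.real (A ∩ cell δ x) := hx
  refine mem_of_inter_cell_nonempty hnest (Set.Nonempty.mono (Set.inter_subset_inter_left _ hA) ?_)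
  rw [Set.nonempty_iff_ne_empty]
  intro h
  rw [h, measureReal_empty] at hx'
  exact absurd hx' (not_lt.2 (by positivity))

/-- A set inside a large cell with small density in all subcells has small density. -/
theorem volume_real_le_mul_pow (hnest : ∀ x : EuclideanSpace ℝ (Fin d), cell δ x ⊆ cell L x)
    (hL : 0 < L) (hδ : 0 < δ) {a : ℝ} (ha : 0 ≤ a) {E : Set (EuclideanSpace ℝ (Fin d))}
    {z : EuclideanSpace ℝ (Fin d)} (hE : E ⊆ cell L z)
    (h : ∀ x, volume.real (E ∩ cell δ x) ≤ a * δ ^ d) : volume.real E ≤ a * L ^ d := by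
  rw [← volume_real_cell hL z]
  refine volume_real_le_of_forall_cell hδ ha (volume_cell_ne_top hL z) fun x => ?_
  by_cases hx : x ∈ cell L z
  · rw [Set.inter_eq_right.2 (cell_subset_of_mem hnest hx), volume_real_cell hδ]
    exact h x
  · have : E ∩ cell δ x = ∅ := by
      rw [← Set.not_nonempty_iff_eq_empty]
      exact fun hne => hx (mem_of_inter_cell_nonempty hnest
        (hne.mono (Set.inter_subset_inter_left _ hE)))
    rw [this, measureReal_empty]
    positivity

/-- Dense cells are removed completely; every other cell holds at most `e * δ ^ d` of `A`. -/
theorem volume_real_diff_denseCells_le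
    (hnest : ∀ x : EuclideanSpace ℝ (Fin d), cell δ x ⊆ cell L x)
    (hL : 0 < L) (hδ : 0 < δ) {e : ℝ} (he : 0 ≤ e)
    {A : Set (EuclideanSpace ℝ (Fin d))} {z : EuclideanSpace ℝ (Fin d)} (hA : A ⊆ cell L z) :
    volume.real (A \ denseCells δ e A) ≤ e * L ^ d := by
  set U := denseCells δ e A with hU
  refine volume_real_le_mul_pow hnest hL hδ he (Set.sdiff_subset.trans hA) fun x => ?_
  by_cases hx : x ∈ U
  · have : (A \ U) ∩ cell δ x = ∅ := by
      ext y
      simp only [Set.mem_inter_iff, Set.mem_sdiff, Set.mem_empty_iff_false, iff_false]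
      exact fun hy => hy.1.2 ((mem_denseCells_iff_of_mem_cell hy.2).2 hx)
    rw [this, measureReal_empty]
    positivity
  · refine le_trans (measureReal_mono (Set.inter_subset_inter_left _ Set.sdiff_subset)
      (measure_ne_top_of_subset Set.inter_subset_right (volume_cell_ne_top hδ x))) ?_
    exact not_lt.1 hx

/-- Split `A` along its dense cells, using the threshold `e` outside them and the uniform bound `β`
inside. This converts a bound on the dense cells into one on `A`. -/
theorem volume_real_le_add_denseCells (hnest : ∀ x : EuclideanSpace ℝ (Fin d), cell δ x ⊆ cell L x)
    (hL : 0 < L) (hδ : 0 < δ) {e β : ℝ} (he : 0 ≤ e) (hβ : 0 ≤ β)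
    {A : Set (EuclideanSpace ℝ (Fin d))} {z : EuclideanSpace ℝ (Fin d)} (hA : A ⊆ cell L z)
    (h : ∀ x, volume.real (A ∩ cell δ x) ≤ β * δ ^ d) :
    volume.real A ≤ e * L ^ d + β * volume.real (denseCells δ e A) := by
  set U := denseCells δ e A with hU
  have hUL : U ⊆ cell L z := denseCells_subset hnest hδ he hA
  have h1 : volume.real (A \ U) ≤ e * L ^ d := volume_real_diff_denseCells_le hnest hL hδ he hA
  have h2 : volume.real (A ∩ U) ≤ β * volume.real U := by
    refine volume_real_le_of_forall_cell hδ hβ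
      (measure_ne_top_of_subset hUL (volume_cell_ne_top hL z)) fun x => ?_
    by_cases hx : x ∈ U
    · have : U ∩ cell δ x = cell δ x :=
        Set.inter_eq_right.2 fun y hy => (mem_denseCells_iff_of_mem_cell hy).2 hx
      rw [this, volume_real_cell hδ]
      exact le_trans (measureReal_mono (Set.inter_subset_inter_left _ Set.inter_subset_left)
        (measure_ne_top_of_subset Set.inter_subset_right (volume_cell_ne_top hδ x))) (h x)
    · have : A ∩ U ∩ cell δ x = ∅ := by
        ext y
        simp only [Set.mem_inter_iff, Set.mem_empty_iff_false, iff_false]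
        exact fun hy => hx ((mem_denseCells_iff_of_mem_cell hy.2).1 hy.1.2)
      rw [this, measureReal_empty]
      positivity
  have h3 := measureReal_sdiff_add_inter (μ := volume) (s := A)
    (measurableSet_denseCells δ e A) (measure_ne_top_of_subset hA (volume_cell_ne_top hL z))
  linarith

/-- Few points lie in dense cells of a fine grid but not in dense cells of a coarse grid, if the
density threshold for the fine grid is much larger. -/
theorem volume_real_denseCells_diff_le {δ' : ℝ}
    (hnest : ∀ x : EuclideanSpace ℝ (Fin d), cell δ x ⊆ cell L x)
    (hnest' : ∀ x : EuclideanSpace ℝ (Fin d), cell δ' x ⊆ cell δ x)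
    (hL : 0 < L) (hδ : 0 < δ) (hδ' : 0 < δ') {e e' : ℝ} (he : 0 ≤ e) (he' : 0 < e')
    {A : Set (EuclideanSpace ℝ (Fin d))} {z : EuclideanSpace ℝ (Fin d)} (hA : A ⊆ cell L z) :
    volume.real (denseCells δ' e' A \ denseCells δ e A) ≤ e / e' * L ^ d := by
  set U := denseCells δ e A with hU
  set U' := denseCells δ' e' A with hU'
  have hAfin : volume A ≠ ∞ := measure_ne_top_of_subset hA (volume_cell_ne_top hL z)
  have h1 : volume.real (A \ U) ≤ e * L ^ d := volume_real_diff_denseCells_le hnest hL hδ he hA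
  have h2 : volume.real (U' \ U) ≤ 1 / e' * volume.real (A \ U) := by
    refine volume_real_le_of_forall_cell hδ' (by positivity)
      (measure_ne_top_of_subset Set.sdiff_subset hAfin) fun x => ?_
    have hUx : ∀ y ∈ cell δ' x, (y ∈ U ↔ x ∈ U) := fun y hy =>
      mem_denseCells_iff_of_mem_cell (hnest' x hy)
    by_cases hx : x ∈ U' \ U
    · have hsub : A ∩ cell δ' x ⊆ (A \ U) ∩ cell δ' x := fun y hy =>
        ⟨⟨hy.1, fun h => hx.2 ((hUx y hy.2).1 h)⟩, hy.2⟩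
      have h3 := measureReal_mono (μ := volume) hsub
        (measure_ne_top_of_subset Set.inter_subset_right (volume_cell_ne_top hδ' x))
      have h4 : e' * δ' ^ d < volume.real (A ∩ cell δ' x) := hx.1
      have h5 : volume.real ((U' \ U) ∩ cell δ' x) ≤ δ' ^ d := by
        rw [← volume_real_cell hδ' x]
        exact measureReal_mono Set.inter_subset_right (volume_cell_ne_top hδ' x)
      refine h5.trans ?_
      rw [one_div, ← div_eq_inv_mul, le_div_iff₀ he']
      linarith
    · have : (U' \ U) ∩ cell δ' x = ∅ := by
        ext y
        simp only [Set.mem_inter_iff, Set.mem_sdiff, Set.mem_empty_iff_false, iff_false]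
        exact fun hy => hx ⟨(mem_denseCells_iff_of_mem_cell hy.2).1 hy.1.1,
          fun h => hy.1.2 ((hUx y hy.2).2 h)⟩
      rw [this, measureReal_empty]
      positivity
  calc volume.real (U' \ U) ≤ 1 / e' * volume.real (A \ U) := h2
    _ ≤ 1 / e' * (e * L ^ d) := by gcongr
    _ = e / e' * L ^ d := by ring

/-- The points of a cell around which a cube of side `s δ` does not fit into the cell. -/
theorem volume_real_not_cube_subset_le
    (hnest : ∀ x : EuclideanSpace ℝ (Fin d), cell δ x ⊆ cell L x)
    (hL : 0 < L) (hδ : 0 < δ) {s : ℝ} (hs0 : 0 < s) (hs1 : s < 1)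
    (z : EuclideanSpace ℝ (Fin d)) :
    volume.real {x | x ∈ cell L z ∧ ¬ cube x (s * δ) ⊆ cell δ x} ≤ (1 - (1 - s) ^ d) * L ^ d := by
  have hpow : (1 - s) ^ d ≤ 1 := pow_le_one₀ (by linarith) (by linarith)
  refine volume_real_le_mul_pow hnest hL hδ (by linarith) (fun x hx => hx.1) fun x => ?_
  set c : EuclideanSpace ℝ (Fin d) := WithLp.toLp 2 fun i => (gridIndex δ x i + 1 / 2) * δ with hc
  have hci : ∀ i, c i = (gridIndex δ x i + 1 / 2) * δ := fun i => rfl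
  have hsδ : 0 < s * δ := by positivity
  have hsub : cube c ((1 - s) * δ) ⊆ cell δ x := by
    intro y hy
    rw [mem_cell_iff hδ]
    intro i
    have := hy i
    rw [hci, abs_lt] at this
    constructor <;> nlinarith
  have hfin := volume_cell_ne_top hδ x
  -- Around a point of the concentric cube of side `(1 - s) * δ`, a cube of side `s * δ` stays in
  -- the cell; so exceptional points lie outside the concentric cube.
  refine le_trans (measureReal_mono (s₂ := cell δ x \ cube c ((1 - s) * δ)) ?_
    (measure_ne_top_of_subset Set.sdiff_subset hfin)) ?_
  · rintro y ⟨⟨-, hy⟩, hyx⟩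
    refine ⟨hyx, fun hyc => hy ?_⟩
    rw [cell_eq_of_mem hyx]
    intro w hw
    rw [mem_cell_iff hδ]
    intro i
    have h1 := hyc i
    have h2 := hw i
    rw [hci, abs_lt] at h1
    rw [abs_lt] at h2
    constructor <;> nlinarith
  · rw [measureReal_sdiff hsub (measurableSet_cube _ _) hfin, volume_real_cell hδ,
      volume_real_cube _ (by nlinarith), mul_pow]
    linarith

/-- If a set `W` fills almost all of a union of cells, then so does its zoomed-out version. -/
theorem volume_real_denseCells_diff_zoomOut_le
    (hnest : ∀ x : EuclideanSpace ℝ (Fin d), cell δ x ⊆ cell L x)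
    (hL : 0 < L) (hδ : 0 < δ) {s ε e : ℝ} (hs0 : 0 < s) (hs1 : s < 1) (hε : 0 < ε) (he : 0 ≤ e)
    {A W : Set (EuclideanSpace ℝ (Fin d))} {z : EuclideanSpace ℝ (Fin d)} (hA : A ⊆ cell L z)
    (hW : MeasurableSet W) :
    volume.real (denseCells δ e A \ zoomOut (s * δ) (1 - ε) W) ≤
      (1 - (1 - s) ^ d) * L ^ d + volume.real (denseCells δ e A \ W) / ε := by
  set U := denseCells δ e A with hU
  have hUL : U ⊆ cell L z := denseCells_subset hnest hδ he hA
  have hsδ : 0 < s * δ := by positivity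
  have hUW : MeasurableSet (U \ W) := (measurableSet_denseCells _ _ _).diff hW
  have hUWfin : volume (U \ W) ≠ ∞ :=
    measure_ne_top_of_subset (Set.sdiff_subset.trans hUL) (volume_cell_ne_top hL z)
  obtain ⟨hfin, hle⟩ := volume_setOf_le_cube_inter hsδ hε hUW hUWfin
  have hfin' : volume {x | x ∈ cell L z ∧ ¬ cube x (s * δ) ⊆ cell δ x} ≠ ∞ :=
    measure_ne_top_of_subset (fun x hx => hx.1) (volume_cell_ne_top hL z)
  refine le_trans (measureReal_mono (s₂ := {x | x ∈ cell L z ∧ ¬ cube x (s * δ) ⊆ cell δ x} ∪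
    {x | ε * (s * δ) ^ d ≤ volume.real (cube x (s * δ) ∩ (U \ W))}) ?_
    (measure_union_ne_top hfin' hfin)) ((measureReal_union_le _ _).trans
      (add_le_add (volume_real_not_cube_subset_le hnest hL hδ hs0 hs1 z) hle))
  rintro x ⟨hxU, hxZ⟩
  -- If the cube fits into its cell, it lies in `U`; as `W` misses a proportion `ε` of it, so does
  -- `U \ W` fill that proportion, and such points are few by the Markov bound.
  by_cases hx : cube x (s * δ) ⊆ cell δ x
  · right
    have hxZ' : volume.real (cube x (s * δ) ∩ W) ≤ (1 - ε) * volume.real (cube x (s * δ)) :=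
      not_lt.1 hxZ
    have hsub : cube x (s * δ) ∩ (U \ W) = cube x (s * δ) \ W := by
      ext y
      constructor
      · exact fun hy => ⟨hy.1, hy.2.2⟩
      · exact fun hy => ⟨hy.1, (mem_denseCells_iff_of_mem_cell (hx hy.1)).2 hxU, hy.2⟩
    change ε * (s * δ) ^ d ≤ volume.real (cube x (s * δ) ∩ (U \ W))
    rw [hsub]
    have h1 := measureReal_inter_add_sdiff (μ := volume) (s := cube x (s * δ)) hW
      (volume_cube_ne_top x _)
    rw [volume_real_cube x hsδ.le] at hxZ' h1
    linarith
  · left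
    exact ⟨hUL hxU, hx⟩

end DenseCells

/-! ### Scale selection by saturation and pigeonhole -/

section Saturation

variable {d : ℕ}

theorem IsSaturationFunction.exists_isLocal {P : SetProperty d}
    {I : Set (EuclideanSpace ℝ (Fin d)) → ℝ≥0∞} (h : IsSaturationFunction P I) :
    ∃ D, IsLocal P D := by
  obtain ⟨D, -, hD⟩ := h.locality
  exact ⟨max D 0, le_max_right _ _, fun A B hA hB hBA => (h.monotone A B hA hB hBA).2,
    fun A hA x => (h.translation A hA x).1, fun A hA hdist => hD A hA fun k l hkl x hx y hy =>
      (le_max_left _ _).trans (hdist k l hkl x hx y hy)⟩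

theorem exists_pow_add_div_lt (d : ℕ) (D : ℝ) {η : ℝ} (hη : 0 < η) :
    ∃ L : ℝ, 0 < L ∧ (L + D) ^ d ≤ (1 + η) * L ^ d := by
  have hlim : Tendsto (fun L : ℝ => (1 + D / L) ^ d) atTop (𝓝 ((1 + 0) ^ d)) :=
    (tendsto_const_nhds.add (tendsto_const_nhds.div_atTop tendsto_id)).pow d
  rw [add_zero, one_pow] at hlim
  obtain ⟨L, h1, h2⟩ := ((hlim.eventually_lt_const (by linarith : (1 : ℝ) < 1 + η)).and
    (eventually_gt_atTop 0)).exists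
  refine ⟨L, h2, ?_⟩
  have : (L + D) ^ d = (1 + D / L) ^ d * L ^ d := by
    rw [← mul_pow]; congr 1; field_simp
  rw [this]
  gcongr

theorem exists_one_sub_pow_le (d : ℕ) {η : ℝ} (hη : 0 < η) :
    ∃ s : ℝ, 0 < s ∧ s < 1 ∧ 1 - (1 - s) ^ d ≤ η := by
  have hlim : Tendsto (fun s : ℝ => 1 - (1 - s) ^ d) (𝓝[>] 0) (𝓝 (1 - (1 - 0) ^ d)) := by
    refine Tendsto.mono_left ?_ nhdsWithin_le_nhds
    exact Continuous.tendsto (by fun_prop) 0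
  rw [sub_zero, one_pow, sub_self] at hlim
  obtain ⟨s, h1, h2⟩ := ((hlim.eventually_lt_const hη).and
    (Ioo_mem_nhdsGT (zero_lt_one' ℝ))).exists
  exact ⟨s, h2.1, h2.2, h1.le⟩

/-- Among sufficiently many numbers in a bounded interval, each of which almost dominates the next,
two consecutive ones almost agree. -/
theorem exists_lt_of_almost_antitone {u v w : ℕ → ℝ} {K : ℕ} {b τ : ℝ} (hu : ∀ k, 0 ≤ u k)
    (hub : u 0 ≤ b) (hw : ∀ k < K, w k ≤ τ)
    (huv : ∀ k < K, u (k + 1) + v k ≤ u k + w k) (hK : b < K * τ) :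
    ∃ k < K, v k ≤ 2 * τ := by
  by_contra! hcon
  -- Otherwise each step loses more than `2 * τ` and regains at most `τ`, so `u` decreases by at
  -- least `τ` per step and becomes negative at `K`.
  have key : ∀ k ≤ K, u k ≤ b - k * τ := by
    intro k
    induction k with
    | zero => intro _; simpa using hub
    | succ k ih =>
      intro hk
      have h1 := ih (by omega)
      have h2 := huv k (by omega)
      have h3 := hcon k (by omega)
      have h4 := hw k (by omega)
      push_cast
      linarith
  have := key K le_rfl
  have := hu K
  linarith

/-- For a set with the property `P` in a fixed cube, the union of the dense cells of the grid of side
`δ / q` has arbitrarily small saturation if `q` is large. -/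
theorem IsSaturationFunction.exists_fine_scale {P : SetProperty d}
    {I : Set (EuclideanSpace ℝ (Fin d)) → ℝ≥0∞} (h : IsSaturationFunction P I) {L : ℝ}
    (hL : 0 < L) {e : ℝ} (he : 0 < e) {c : ℝ≥0} (hc : 0 < c) {δ : ℝ} (hδ : 0 < δ) :
    ∃ q : ℕ, 0 < q ∧ ∀ A, MeasurableSet A → A ⊆ cell L 0 → P A →
      I (denseCells (δ / q) e A) < c := by
  obtain ⟨g, k, hg, hk, hI⟩ := h.zoomingOut
  have he' : 0 < e / 2 ^ d := by positivity
  have hscale : Tendsto (fun q : ℕ => 2 * (δ / q)) atTop (𝓝[>] 0) := by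
    rw [tendsto_nhdsWithin_iff]
    constructor
    · simpa using (tendsto_const_div_atTop_nhds_zero_nat δ).const_mul 2
    · filter_upwards [eventually_gt_atTop 0] with q hq
      have : (0 : ℝ) < q := by exact_mod_cast hq
      exact Set.mem_Ioi.2 (by positivity)
  have hlim : Tendsto (fun q : ℕ => k (e / 2 ^ d) (2 * (δ / q)) * (2 * L).toNNReal ^ d) atTop
      (𝓝 (0 * (2 * L).toNNReal ^ d)) := ((hk _ he').comp hscale).mul_const _
  rw [zero_mul] at hlim
  have hgc : 0 < g (e / 2 ^ d) * c := mul_pos (hg _ he') hc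
  obtain ⟨q, hq, hq0⟩ := ((hlim.eventually_lt_const hgc).and (eventually_gt_atTop 0)).exists
  refine ⟨q, hq0, fun A hA hAL hPA => ?_⟩
  have hq0' : (0 : ℝ) < q := by exact_mod_cast hq0
  have h1 := hI (e / 2 ^ d) (2 * (δ / q)) (2 * L) he' (by positivity) (by positivity) A
    hA.nullMeasurableSet (hAL.trans (cell_zero_subset_cube hL))
  -- Positivity makes the saturation of `A` vanish, leaving only the error term `h`, which is small
  -- at fine scales since `A` lies in a fixed cube.
  have hIA : I A = 0 := by
    by_contra hne
    exact h.positivity A hA.nullMeasurableSet (pos_iff_ne_zero.2 hne) hPA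
  rw [hIA, zero_add] at h1
  have h2 : I (denseCells (δ / q) e A) ≤ I (zoomOut (2 * (δ / q)) (e / 2 ^ d) A) :=
    (h.monotone _ _ (measurableSet_zoomOut _ _ hA.nullMeasurableSet).nullMeasurableSet
      (measurableSet_denseCells _ _ _).nullMeasurableSet
      (denseCells_subset_zoomOut (by positivity) A)).1
  refine h2.trans_lt ?_
  have h3 : (g (e / 2 ^ d) : ℝ≥0∞) * I (zoomOut (2 * (δ / q)) (e / 2 ^ d) A) <
      g (e / 2 ^ d) * c := by
    refine h1.trans_lt ?_
    rw [ENNReal.ofReal]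
    exact_mod_cast hq
  exact lt_of_mul_lt_mul_left' h3

/-- For a set with the property `P` in a fixed large cube, some scale out of a fixed finite list
has the property that the cells meeting the set in a substantial part have density at most about
`m(P)`. So upper bounds on the densities in all cells of these scales are improved by the
factor `m(P)`, up to small errors. -/
theorem IsSaturationFunction.exists_scales {P : SetProperty d}
    {I : Set (EuclideanSpace ℝ (Fin d)) → ℝ≥0∞} (h : IsSaturationFunction P I) {η : ℝ}
    (hη : 0 < η) :
    ∃ (L : ℝ) (K : ℕ) (δ : ℕ → ℝ), 0 < L ∧ (∀ k, 0 < δ k) ∧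
      ∀ A, MeasurableSet A → A ⊆ cell L 0 → P A → ∀ β, 0 ≤ β →
        (∀ k < K, ∀ x, volume.real (A ∩ cell (δ k) x) ≤ β * δ k ^ d) →
        volume.real A ≤ (β * ((maxDensity P).toReal + η) + η) * L ^ d := by
  obtain ⟨D, hP⟩ := h.exists_isLocal
  obtain ⟨ε, hε, f, hf, hzoom⟩ := h.zoomability
  -- Error budget for `|U k| ≤ (m + η) L ^ d`: `η / 2` for the tiling gap, `η / 4` for cell
  -- boundaries (`s`), `η / 4` for the pigeonhole error `2 * τ / ε`.
  obtain ⟨L, hL, hLD⟩ := exists_pow_add_div_lt d D (half_pos hη)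
  obtain ⟨s, hs0, hs1, hs⟩ := exists_one_sub_pow_le d (by positivity : 0 < η / 4)
  set m := (maxDensity P).toReal with hm
  have hm1 : m ≤ 1 := toReal_maxDensity_le_one P
  have hm0 : 0 ≤ m := ENNReal.toReal_nonneg
  set τ := min 1 (ε * η / 8) with hτ
  have hτ0 : 0 < τ := lt_min one_pos (by positivity)
  have hτ1 : τ ≤ 1 := min_le_left _ _
  have hτε : 2 * τ / ε ≤ η / 4 := by
    rw [div_le_iff₀ hε]
    have : τ ≤ ε * η / 8 := min_le_right _ _
    linarith
  obtain ⟨K, hK⟩ := exists_nat_gt (1 / τ)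
  rw [div_lt_iff₀ hτ0] at hK
  -- Thresholds grow by the factor `1 / τ` per step and reach `η` at `K`, so that `U (k + 1) \ U k`
  -- has volume at most `τ * L ^ d`.
  set e : ℕ → ℝ := fun k => η * τ ^ (K - k) with he
  have he0 : ∀ k, 0 < e k := fun k => by positivity
  have heη : ∀ k, e k ≤ η := fun k =>
    mul_le_of_le_one_right hη.le (pow_le_one₀ hτ0.le hτ1)
  have hestep : ∀ k < K, e k / e (k + 1) = τ := by
    intro k hk
    simp only [he]
    rw [show K - k = (K - (k + 1)) + 1 by omega, pow_succ]
    field_simp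
  have hstep : ∀ (k : ℕ) (δ : ℝ), ∃ q : ℕ, 0 < q ∧ (0 < δ → ∀ A, MeasurableSet A →
      A ⊆ cell L 0 → P A → I (denseCells (δ / q) (e (k + 1)) A) < f (s * δ)) := by
    intro k δ
    by_cases hδ : 0 < δ
    · obtain ⟨q, hq, hq'⟩ := h.exists_fine_scale hL (he0 (k + 1)) (hf (s * δ) (by positivity)) hδ
      exact ⟨q, hq, fun _ => hq'⟩
    · exact ⟨1, one_pos, fun h => absurd h hδ⟩
  choose q hq0 hq using hstep
  -- Each side is an integer fraction of the previous one, starting from `L`. The list is fixed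
  -- before `A` is chosen.
  set δ : ℕ → ℝ := fun k => Nat.rec L (fun k x => x / q k x) k with hδ
  have hδsucc : ∀ k, δ (k + 1) = δ k / q k (δ k) := fun k => rfl
  have hδ0 : ∀ k, 0 < δ k := by
    intro k
    induction k with
    | zero => exact hL
    | succ k ih =>
      rw [hδsucc]
      have : (0 : ℝ) < q k (δ k) := by exact_mod_cast hq0 _ _
      positivity
  have hnest' : ∀ k, ∀ x : EuclideanSpace ℝ (Fin d), cell (δ (k + 1)) x ⊆ cell (δ k) x :=
    fun k x => by
      rw [hδsucc]
      exact cell_div_subset_cell (hq0 _ _) x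
  have hnest : ∀ k, ∀ x : EuclideanSpace ℝ (Fin d), cell (δ k) x ⊆ cell L x := by
    intro k x
    induction k with
    | zero => exact subset_rfl
    | succ k ih => exact (hnest' k x).trans ih
  refine ⟨L, K, δ, hL, hδ0, fun A hA hAL hPA β hβ hdens => ?_⟩
  have hLpos : 0 < L ^ d := by positivity
  set U : ℕ → Set (EuclideanSpace ℝ (Fin d)) := fun k => denseCells (δ k) (e k) A with hU
  have hUm : ∀ k, MeasurableSet (U k) := fun k => measurableSet_denseCells _ _ _
  have hUL : ∀ k, U k ⊆ cell L 0 := fun k => denseCells_subset (hnest k) (hδ0 k) (he0 k).le hAL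
  have hUfin : ∀ k, volume (U k) ≠ ∞ := fun k =>
    measure_ne_top_of_subset (hUL k) (volume_cell_ne_top hL 0)
  obtain ⟨k, hkK, hk⟩ : ∃ k < K, volume.real (U k \ U (k + 1)) ≤ 2 * (τ * L ^ d) := by
    refine exists_lt_of_almost_antitone (u := fun k => volume.real (U k))
      (w := fun k => volume.real (U (k + 1) \ U k)) (b := L ^ d) (fun k => measureReal_nonneg)
      ?_ (fun k hk => ?_) (fun k _ => ?_) ?_
    · rw [← volume_real_cell hL 0]
      exact measureReal_mono (hUL 0) (volume_cell_ne_top hL 0)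
    · have := volume_real_denseCells_diff_le (hnest k) (hnest' k) hL (hδ0 k) (hδ0 (k + 1))
        (he0 k).le (he0 (k + 1)) hAL
      rwa [hestep k hk] at this
    · have h1 := measureReal_sdiff_add_inter (μ := volume) (s := U k) (hUm (k + 1)) (hUfin k)
      have h2 := measureReal_sdiff_add_inter (μ := volume) (s := U (k + 1)) (hUm k) (hUfin _)
      rw [Set.inter_comm] at h2
      linarith
    · rw [← mul_assoc]
      exact lt_mul_of_one_lt_left hLpos hK
  have hρ : 0 < s * δ k := mul_pos hs0 (hδ0 k)
  have hZm := measurableSet_zoomOut (s * δ k) (1 - ε) (hUm (k + 1)).nullMeasurableSet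
  set Z := zoomOut (s * δ k) (1 - ε) (U (k + 1)) with hZ
  -- By the choice of `δ (k + 1)`, the saturation of `U (k + 1)` is below the value `f (s * δ k)`
  -- that failure of `P` for `Z` would force.
  have hPZ : P Z := by
    by_contra hne
    have h1 := hzoom (s * δ k) hρ (U (k + 1)) (hUm _).nullMeasurableSet hne
    exact absurd (hq k (δ k) (hδ0 k) A hA hAL hPA) (not_lt.2 h1)
  have hZL := hZm.inter (measurableSet_cell hL (0 : EuclideanSpace ℝ (Fin d)))
  have h1 : volume.real (Z ∩ cell L 0) ≤ m * (L + D) ^ d :=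
    hP.volume_real_le hL hZL (hP.mono _ _ hZm.nullMeasurableSet hZL.nullMeasurableSet
      Set.inter_subset_left hPZ) Set.inter_subset_right
  have h2 : volume.real (U k \ Z) ≤ (1 - (1 - s) ^ d) * L ^ d + volume.real (U k \ U (k + 1)) / ε :=
    volume_real_denseCells_diff_zoomOut_le (hnest k) hL (hδ0 k) hs0 hs1 hε (he0 k).le hAL (hUm _)
  have h3 : volume.real (U k ∩ Z) ≤ volume.real (Z ∩ cell L 0) :=
    measureReal_mono (fun x hx => ⟨hx.2, hUL k hx.1⟩)
      (measure_ne_top_of_subset Set.inter_subset_right (volume_cell_ne_top hL 0))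
  have h4 := measureReal_sdiff_add_inter (μ := volume) (s := U k) hZm (hUfin k)
  have h5 : volume.real (U k \ U (k + 1)) / ε ≤ η / 4 * L ^ d := by
    calc volume.real (U k \ U (k + 1)) / ε ≤ 2 * (τ * L ^ d) / ε := by gcongr
      _ = 2 * τ / ε * L ^ d := by ring
      _ ≤ η / 4 * L ^ d := by gcongr
  have h6 : (1 - (1 - s) ^ d) * L ^ d ≤ η / 4 * L ^ d := by gcongr
  have h7 : m * (L + D) ^ d ≤ (m + η / 2) * L ^ d := by
    calc m * (L + D) ^ d ≤ m * ((1 + η / 2) * L ^ d) := by gcongr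
      _ = (m + m * (η / 2)) * L ^ d := by ring
      _ ≤ (m + 1 * (η / 2)) * L ^ d := by gcongr
      _ = (m + η / 2) * L ^ d := by ring
  have h8 : volume.real (U k) ≤ (m + η) * L ^ d := by linarith
  calc volume.real A ≤ e k * L ^ d + β * volume.real (U k) :=
        volume_real_le_add_denseCells (hnest k) hL (hδ0 k) (he0 k).le hβ hAL (hdens k hkK)
    _ ≤ η * L ^ d + β * ((m + η) * L ^ d) := by
        have := heη k
        gcongr
    _ = (β * (m + η) + η) * L ^ d := by ring

end Saturation

/-! ### Conjunctions, dilations and separated scales -/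

section Conjunction

variable {d : ℕ}

theorem IsLocal.mono_dist {P : SetProperty d} {D D' : ℝ} (hP : IsLocal P D) (h : D ≤ D') :
    IsLocal P D' :=
  ⟨hP.nonneg.trans h, hP.mono, hP.vadd, fun A hA hdist => hP.iUnion A hA fun k l hkl x hx y hy =>
    h.trans (hdist k l hkl x hx y hy)⟩

theorem isLocal_forall {ι : Type*} {s : Finset ι} {P : ι → SetProperty d} {D : ℝ} (hD : 0 ≤ D)
    (hP : ∀ i ∈ s, IsLocal (P i) D) : IsLocal (fun A => ∀ i ∈ s, P i A) D where
  nonneg := hD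
  mono A B hA hB hBA h i hi := (hP i hi).mono A B hA hB hBA (h i hi)
  vadd A hA x := forall₂_congr fun i hi => (hP i hi).vadd A hA x
  iUnion A hA hdist := by
    constructor
    · exact fun h k i hi => ((hP i hi).iUnion A hA hdist).1 (h i hi) k
    · exact fun h i hi => ((hP i hi).iUnion A hA hdist).2 fun k => h k i hi

theorem nullMeasurableSet_smul {A : Set (EuclideanSpace ℝ (Fin d))}
    (hA : NullMeasurableSet A volume) (t : ℝ) : NullMeasurableSet (t • A) volume :=
  Measure.NullMeasurableSet.const_smul hA t

theorem volume_real_smul {t : ℝ} (ht : 0 ≤ t) (A : Set (EuclideanSpace ℝ (Fin d))) :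
    volume.real (t • A) = t ^ d * volume.real A := by
  rw [Measure.real, Measure.addHaar_smul, finrank_euclideanSpace_fin, ENNReal.toReal_mul,
    abs_of_nonneg (by positivity), ENNReal.toReal_ofReal (by positivity), Measure.real]

theorem IsLocal.dilate {P : SetProperty d} {D : ℝ} (hP : IsLocal P D) {t : ℝ} (ht : 0 < t) :
    IsLocal (dilate t P) (t * D) where
  nonneg := mul_nonneg ht.le hP.nonneg
  mono A B hA hB hBA h := hP.mono _ _ (nullMeasurableSet_smul hA _)
    (nullMeasurableSet_smul hB _) (Set.smul_set_mono hBA) h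
  vadd A hA x := by
    have : t⁻¹ • (x +ᵥ A) = (t⁻¹ • x) +ᵥ (t⁻¹ • A) := by
      ext y
      simp only [Set.mem_smul_set, Set.mem_vadd_set, vadd_eq_add]
      constructor
      · rintro ⟨_, ⟨a, ha, rfl⟩, rfl⟩
        exact ⟨_, ⟨a, ha, rfl⟩, (smul_add _ _ _).symm⟩
      · rintro ⟨_, ⟨a, ha, rfl⟩, rfl⟩
        exact ⟨_, ⟨a, ha, rfl⟩, smul_add _ _ _⟩
    change P (t⁻¹ • (x +ᵥ A)) ↔ P (t⁻¹ • A)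
    rw [this]
    exact hP.vadd _ (nullMeasurableSet_smul hA _) _
  iUnion A hA hdist := by
    change P (t⁻¹ • ⋃ k, A k) ↔ ∀ k, P (t⁻¹ • A k)
    rw [Set.smul_set_iUnion]
    refine hP.iUnion _ (fun k => nullMeasurableSet_smul (hA k) _) ?_
    rintro k l hkl _ ⟨a, ha, rfl⟩ _ ⟨b, hb, rfl⟩
    have h1 := hdist k l hkl a ha b hb
    change D ≤ dist (t⁻¹ • a) (t⁻¹ • b)
    rw [dist_smul₀, Real.norm_of_nonneg (by positivity), ← div_eq_inv_mul, le_div_iff₀ ht]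
    linarith

theorem smul_mem_cube_iff {t : ℝ} (ht : 0 < t) {y : EuclideanSpace ℝ (Fin d)} {R : ℝ} :
    t • y ∈ cube 0 (t * R) ↔ y ∈ cube 0 R := by
  refine forall_congr' fun i => ?_
  simp only [PiLp.smul_apply, smul_eq_mul, PiLp.zero_apply, sub_zero, abs_mul, abs_of_pos ht,
    mul_div_assoc]
  exact mul_lt_mul_iff_right₀ ht

theorem smul_mem_cell_iff {t : ℝ} (ht : 0 < t) {x y : EuclideanSpace ℝ (Fin d)} {δ : ℝ} :
    t • y ∈ cell (t * δ) (t • x) ↔ y ∈ cell δ x := by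
  have key : ∀ z : EuclideanSpace ℝ (Fin d), gridIndex (t * δ) (t • z) = gridIndex δ z := by
    intro z
    funext i
    simp only [gridIndex, PiLp.smul_apply, smul_eq_mul, mul_div_mul_left _ _ ht.ne']
  simp only [cell, Set.mem_ofPred_eq, key]

theorem upperDensity_le_smul {t : ℝ} (ht : 0 < t) (A : Set (EuclideanSpace ℝ (Fin d))) :
    upperDensity A ≤ upperDensity (t • A) := by
  have key : ∀ R, density (cube 0 R) A = density (cube 0 (t * R)) (t • A) := by
    intro R
    have h1 : cube (0 : EuclideanSpace ℝ (Fin d)) (t * R) = t • cube 0 R := by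
      ext y
      rw [Set.mem_smul_set_iff_inv_smul_mem₀ ht.ne', ← smul_mem_cube_iff ht (y := t⁻¹ • y),
        smul_inv_smul₀ ht.ne']
    rw [density, density, h1, ← Set.smul_set_inter₀ ht.ne', Measure.addHaar_smul,
      Measure.addHaar_smul, ENNReal.mul_div_mul_left _ _
        (ENNReal.ofReal_pos.2 (abs_pos.2 (pow_ne_zero _ ht.ne'))).ne' ENNReal.ofReal_ne_top]
  simp only [upperDensity]
  simp_rw [key]
  have hmap : map (fun R => t * R) atTop ≤ atTop := tendsto_id.const_mul_atTop ht
  exact limsup_le_limsup_of_le (f := map (fun R => t * R) atTop)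
    (u := fun R => density (cube 0 R) (t • A)) hmap (by isBoundedDefault) (by isBoundedDefault)

theorem maxDensity_le_dilate {t : ℝ} (ht : 0 < t) (P : SetProperty d) :
    maxDensity P ≤ maxDensity (dilate t P) := by
  refine iSup_le fun A => iSup_le fun hA => iSup_le fun hPA => ?_
  refine (upperDensity_le_smul ht A).trans ?_
  refine le_iSup_of_le (t • A) (le_iSup_of_le (nullMeasurableSet_smul hA _)
    (le_iSup_of_le ?_ le_rfl))
  change P (t⁻¹ • t • A)
  rwa [inv_smul_smul₀ ht.ne']

/-- Each new property is imposed by averaging inside the set already found; monotonicity preserves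
the earlier ones. -/
theorem exists_subset_forall_of_lt_maxDensity {ι : Type*} (s : Finset ι) {P : ι → SetProperty d}
    {D : ℝ} (hP : ∀ i ∈ s, IsLocal (P i) D) {c : ι → ℝ} (hc0 : ∀ i ∈ s, 0 ≤ c i)
    (hc : ∀ i ∈ s, c i < (maxDensity (P i)).toReal) {S : Set (EuclideanSpace ℝ (Fin d))}
    (hS : MeasurableSet S) {r : ℝ} (hSr : S ⊆ cube 0 r) :
    ∃ B ⊆ S, MeasurableSet B ∧ (∀ i ∈ s, P i B) ∧
      (∏ i ∈ s, c i) * volume.real S ≤ volume.real B := by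
  classical
  induction s using Finset.induction_on with
  | empty => exact ⟨S, subset_rfl, hS, by simp, by simp⟩
  | insert a s ha ih =>
    obtain ⟨B, hBS, hB, hPB, hle⟩ := ih (fun i hi => hP i (Finset.mem_insert_of_mem hi))
      (fun i hi => hc0 i (Finset.mem_insert_of_mem hi))
      (fun i hi => hc i (Finset.mem_insert_of_mem hi))
    have haP := hP a (Finset.mem_insert_self a s)
    have hca := hc0 a (Finset.mem_insert_self a s)
    obtain ⟨B', hB'B, hB', hPB', hle'⟩ := exists_subset_of_lt_maxDensity haP.mono haP.vadd hca
      (hc a (Finset.mem_insert_self a s)) hB (hBS.trans hSr)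
    refine ⟨B', hB'B.trans hBS, hB', fun i hi => ?_, ?_⟩
    · rcases Finset.mem_insert.1 hi with rfl | hi'
      · exact hPB'
      · exact (hP i hi).mono _ _ hB.nullMeasurableSet hB'.nullMeasurableSet hB'B (hPB i hi')
    · rw [Finset.prod_insert ha, mul_assoc]
      exact (mul_le_mul_of_nonneg_left hle hca).trans hle'

/-- The density of a conjunction of local properties is at least the product of their
densities. -/
theorem prod_maxDensity_le {ι : Type*} (s : Finset ι) {P : ι → SetProperty d} {D : ℝ} (hD : 0 ≤ D)
    (hP : ∀ i ∈ s, IsLocal (P i) D) (hpos : ∀ i ∈ s, 0 < (maxDensity (P i)).toReal) :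
    ∏ i ∈ s, (maxDensity (P i)).toReal ≤ (maxDensity fun A => ∀ i ∈ s, P i A).toReal := by
  set M := (maxDensity fun A => ∀ i ∈ s, P i A).toReal with hM
  have hM0 : 0 ≤ M := ENNReal.toReal_nonneg
  have hM1 : M ≤ 1 := toReal_maxDensity_le_one _
  refine le_of_forall_pos_le_add fun η hη => ?_
  obtain ⟨L, hL, hLD⟩ := exists_pow_add_div_lt d D (half_pos hη)
  obtain ⟨κ, hκ0, hκ1, hκ⟩ := exists_one_sub_pow_le s.card (half_pos hη)
  obtain ⟨B, hBS, hB, hPB, hle⟩ := exists_subset_forall_of_lt_maxDensity s hP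
    (c := fun i => (1 - κ) * (maxDensity (P i)).toReal)
    (fun i _ => mul_nonneg (by linarith) ENNReal.toReal_nonneg)
    (fun i hi => mul_lt_of_lt_one_left (hpos i hi) (by linarith)) (measurableSet_cell hL 0)
    (cell_zero_subset_cube hL)
  have h1 := (isLocal_forall hD hP).volume_real_le hL hB hPB hBS
  rw [volume_real_cell hL, Finset.prod_mul_distrib, Finset.prod_const] at hle
  set p := ∏ i ∈ s, (maxDensity (P i)).toReal with hp
  have hp0 : 0 ≤ p := Finset.prod_nonneg fun i _ => ENNReal.toReal_nonneg
  have hp1 : p ≤ 1 := Finset.prod_le_one (fun i _ => ENNReal.toReal_nonneg)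
    fun i _ => toReal_maxDensity_le_one _
  have hLpos : 0 < L ^ d := by positivity
  have h2 : (1 - κ) ^ s.card * p * L ^ d ≤ M * (1 + η / 2) * L ^ d := by
    refine hle.trans (h1.trans ?_)
    rw [mul_assoc]
    gcongr
  have h3 := le_of_mul_le_mul_right h2 hLpos
  -- Since `p` and `M` are at most `1`, replacing `(1 - κ) ^ s.card` and `1 + η / 2` by `1` costs at
  -- most `η / 2` each.
  nlinarith

/-- Requiring a supersaturable property at a scale much larger than the one of another property
multiplies the density by approximately its own density. -/
theorem IsSaturationFunction.exists_scale_separation {P : SetProperty d}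
    {I : Set (EuclideanSpace ℝ (Fin d)) → ℝ≥0∞} (h : IsSaturationFunction P I) {η : ℝ}
    (hη : 0 < η) :
    ∃ κ : ℝ, 0 < κ ∧ ∀ t : ℝ, 0 < t → ∀ Q : SetProperty d, IsLocal Q (t * κ) →
      (maxDensity fun A => dilate t P A ∧ Q A).toReal ≤
        (maxDensity Q).toReal * (1 + η) * ((maxDensity P).toReal + η) + η := by
  obtain ⟨L, K, δ, hL, hδ, hscales⟩ := h.exists_scales hη
  obtain ⟨D, hP⟩ := h.exists_isLocal
  -- Finitely many scales, so one `κ` makes the gap in the tiling bound for `Q` negligible at all of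
  -- them.
  have hev : ∀ᶠ κ : ℝ in 𝓝[>] 0, ∀ k ∈ Finset.range K, (δ k + κ) ^ d < (1 + η) * δ k ^ d := by
    rw [Filter.eventually_all_finset]
    intro k _
    refine nhdsWithin_le_nhds ?_
    have hcont : Tendsto (fun κ : ℝ => (δ k + κ) ^ d) (𝓝 0) (𝓝 ((δ k + 0) ^ d)) :=
      Continuous.tendsto (by fun_prop) 0
    refine hcont.eventually_lt_const ?_
    rw [add_zero]
    have : 0 < δ k ^ d := pow_pos (hδ k) d
    nlinarith
  obtain ⟨κ, hκ, hκ0⟩ := (hev.and self_mem_nhdsWithin).exists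
  refine ⟨κ, hκ0, fun t ht Q hQ => ?_⟩
  have hPt := hP.dilate ht
  refine le_of_forall_lt fun c hc => ?_
  obtain ⟨c', hcc', hc'⟩ := exists_between hc
  refine hcc'.trans_le ?_
  have hM0 : 0 ≤ (maxDensity P).toReal := ENNReal.toReal_nonneg
  have hQ0 : 0 ≤ (maxDensity Q).toReal := ENNReal.toReal_nonneg
  rcases lt_or_ge c' 0 with hc0 | hc0
  · exact hc0.le.trans (by positivity)
  have htL : 0 < t * L := by positivity
  obtain ⟨A, hAS, hA, ⟨hPA, hQA⟩, hle⟩ := exists_subset_of_lt_maxDensity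
    (P := fun A => dilate t P A ∧ Q A)
    (fun A B hA hB hBA h => ⟨hPt.mono A B hA hB hBA h.1, hQ.mono A B hA hB hBA h.2⟩)
    (fun A hA x => and_congr (hPt.vadd A hA x) (hQ.vadd A hA x)) hc0 hc'
    (measurableSet_cell htL 0) (cell_zero_subset_cube htL)
  rw [volume_real_cell htL] at hle
  have hvol : ∀ B : Set (EuclideanSpace ℝ (Fin d)),
      t ^ d * volume.real (t⁻¹ • B) = volume.real B := by
    intro B
    rw [← volume_real_smul ht.le, smul_inv_smul₀ ht.ne']
  have htd : 0 < t ^ d := by positivity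
  -- Rescaled by `1 / t`, the set satisfies `P`, and the tiling bound for `Q` supplies the cell
  -- density bound `β = m(Q) * (1 + η)`.
  have hmain := hscales (t⁻¹ • A) (hA.const_smul₀ _) ?_ hPA ((maxDensity Q).toReal * (1 + η))
    (by positivity) ?_
  · rw [← mul_le_mul_iff_right₀ htd, hvol] at hmain
    have h1 : c' * (t * L) ^ d ≤ ((maxDensity Q).toReal * (1 + η) * ((maxDensity P).toReal + η) + η)
        * (t * L) ^ d := by
      refine hle.trans (hmain.trans (le_of_eq ?_))
      ring
    exact le_of_mul_le_mul_right h1 (by positivity)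
  · rintro _ ⟨a, ha, rfl⟩
    change t⁻¹ • a ∈ cell L 0
    rw [← smul_mem_cell_iff ht, smul_inv_smul₀ ht.ne', smul_zero]
    exact hAS ha
  · intro k hk x
    have hset : (t⁻¹ • A) ∩ cell (δ k) x = t⁻¹ • (A ∩ cell (t * δ k) (t • x)) := by
      ext y
      rw [Set.mem_inter_iff, Set.mem_smul_set_iff_inv_smul_mem₀ (inv_ne_zero ht.ne'),
        Set.mem_smul_set_iff_inv_smul_mem₀ (inv_ne_zero ht.ne'), inv_inv, Set.mem_inter_iff,
        smul_mem_cell_iff ht]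
    have htδ : 0 < t * δ k := mul_pos ht (hδ k)
    have hm := hA.inter (measurableSet_cell htδ (t • x))
    have h1 := hQ.volume_real_le htδ hm
      (hQ.mono _ _ hA.nullMeasurableSet hm.nullMeasurableSet Set.inter_subset_left hQA)
      Set.inter_subset_right
    rw [← hvol, ← mul_add, mul_pow, mul_left_comm, mul_le_mul_iff_right₀ htd, ← hset] at h1
    refine h1.trans ?_
    rw [mul_assoc]
    exact mul_le_mul_of_nonneg_left (hκ k (Finset.mem_range.2 hk)).le hQ0

/-- When `a` joins a set dominated by `b`, either `b` still dominates or `a` takes over, as `t j / t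
a = (t j / t b) * (t b / t a)`. -/
theorem exists_dominating_index {n : ℕ} {ι : Type*} {l : Filter ι} {t : Fin n → ι → ℝ}
    (ht : ∀ i s, 0 < t i s)
    (hratio : ∀ i j, i ≠ j →
      Tendsto (fun s => t i s / t j s) l (𝓝 0) ∨ Tendsto (fun s => t i s / t j s) l atTop)
    {s : Finset (Fin n)} (hs : s.Nonempty) :
    ∃ i ∈ s, ∀ j ∈ s, j ≠ i → Tendsto (fun x => t j x / t i x) l (𝓝 0) := by
  induction hs using Finset.Nonempty.cons_induction with
  | singleton a =>
    refine ⟨a, Finset.mem_singleton_self a, fun j hj hja => ?_⟩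
    exact absurd (Finset.mem_singleton.1 hj) hja
  | cons a s ha hs ih =>
    obtain ⟨b, hb, hmax⟩ := ih
    have hab : a ≠ b := fun h => ha (h ▸ hb)
    rcases hratio a b hab with h | h
    · refine ⟨b, Finset.mem_cons_of_mem hb, fun j hj hjb => ?_⟩
      rcases Finset.mem_cons.1 hj with rfl | hj
      · exact h
      · exact hmax j hj hjb
    · refine ⟨a, Finset.mem_cons_self a s, fun j hj hja => ?_⟩
      have hba : Tendsto (fun x => t b x / t a x) l (𝓝 0) := by
        refine h.inv_tendsto_atTop.congr fun x => ?_
        simp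
      rcases Finset.mem_cons.1 hj with rfl | hj
      · exact absurd rfl hja
      · by_cases hjb : j = b
        · rwa [hjb]
        · have := (hmax j hj hjb).mul hba
          rw [mul_zero] at this
          refine this.congr fun x => ?_
          exact div_mul_div_cancel₀ (ht b x).ne'

/-- Induction on `s`: the property with dominating scale is split off, and the conjunction of the
others plays the role of `Q` in `exists_scale_separation`. -/
theorem eventually_maxDensity_lt {n : ℕ} {P : Fin n → SetProperty d}
    (hP : ∀ i, Supersaturable (P i)) {ι : Type*} {l : Filter ι} {t : Fin n → ι → ℝ}
    (ht : ∀ i s, 0 < t i s)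
    (hratio : ∀ i j, i ≠ j →
      Tendsto (fun s => t i s / t j s) l (𝓝 0) ∨ Tendsto (fun s => t i s / t j s) l atTop)
    (s : Finset (Fin n)) {c : ℝ} (hc : ∏ i ∈ s, (maxDensity (P i)).toReal < c) :
    ∀ᶠ x in l, (maxDensity fun A => ∀ i ∈ s, dilate (t i x) (P i) A).toReal < c := by
  induction s using Finset.strongInduction generalizing c with
  | H s ih =>
    rcases s.eq_empty_or_nonempty with rfl | hs
    · rw [Finset.prod_empty] at hc
      exact Eventually.of_forall fun x => (toReal_maxDensity_le_one _).trans_lt hc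
    obtain ⟨a, ha, hmax⟩ := exists_dominating_index ht hratio hs
    obtain ⟨I, hI⟩ := hP a
    rw [← Finset.prod_erase_mul _ _ ha] at hc
    set p := ∏ i ∈ s.erase a, (maxDensity (P i)).toReal with hp
    set m := (maxDensity (P a)).toReal with hm
    have hm0 : 0 ≤ m := ENNReal.toReal_nonneg
    have hcont : Tendsto (fun η : ℝ => (p + η) * (1 + η) * (m + η) + η) (𝓝[>] 0)
        (𝓝 ((p + 0) * (1 + 0) * (m + 0) + 0)) :=
      Tendsto.mono_left (Continuous.tendsto (by fun_prop) 0) nhdsWithin_le_nhds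
    simp only [add_zero, mul_one] at hcont
    obtain ⟨η, hηc, hη⟩ := ((hcont.eventually_lt_const hc).and self_mem_nhdsWithin).exists
    have hη0 : 0 < η := hη
    obtain ⟨κ, hκ, hsep⟩ := hI.exists_scale_separation hη0
    have hsat : ∀ i, ∃ D, IsLocal (P i) D := fun i => by
      obtain ⟨J, hJ⟩ := hP i
      exact hJ.exists_isLocal
    choose D hD using hsat
    -- Because `t j / t a` tends to `0`, the separation distances of the remaining properties
    -- eventually fall below `t a * κ`.
    have hloc : ∀ᶠ x in l, ∀ j ∈ s.erase a, t j x * D j ≤ t a x * κ := by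
      rw [Filter.eventually_all_finset]
      intro j hj
      have h1 := (hmax j (Finset.mem_of_mem_erase hj) (Finset.ne_of_mem_erase hj)).mul_const (D j)
      rw [zero_mul] at h1
      filter_upwards [h1.eventually_lt_const hκ] with x hx
      rw [div_mul_eq_mul_div, div_lt_iff₀ (ht a x)] at hx
      linarith
    filter_upwards [hloc, ih _ (Finset.erase_ssubset ha) (lt_add_of_pos_right p hη0)] with x hx hx'
    have hQ : IsLocal (fun A => ∀ i ∈ s.erase a, dilate (t i x) (P i) A) (t a x * κ) :=
      isLocal_forall (mul_nonneg (ht a x).le hκ.le) fun i hi =>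
        ((hD i).dilate (ht i x)).mono_dist (hx i hi)
    have heq : (fun A => ∀ i ∈ s, dilate (t i x) (P i) A) = fun A => dilate (t a x) (P a) A ∧
        ∀ i ∈ s.erase a, dilate (t i x) (P i) A := by
      funext A
      rw [← Finset.forall_mem_insert a (s.erase a) fun i => dilate (t i x) (P i) A,
        Finset.insert_erase ha]
    rw [heq]
    refine (hsep (t a x) (ht a x) _ hQ).trans_lt (lt_of_le_of_lt ?_ hηc)
    gcongr

theorem prod_maxDensity_le_dilate {n : ℕ} {P : Fin n → SetProperty d}
    (hP : ∀ i, Supersaturable (P i)) {t : Fin n → ℝ} (ht : ∀ i, 0 < t i) :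
    ∏ i, maxDensity (P i) ≤ maxDensity (conj fun i => dilate (t i) (P i)) := by
  have hsat : ∀ i, ∃ D, IsLocal (P i) D := fun i => by
    obtain ⟨J, hJ⟩ := hP i
    exact hJ.exists_isLocal
  choose D hD using hsat
  have hnn : ∀ i, 0 ≤ t i * D i := fun i => mul_nonneg (ht i).le (hD i).nonneg
  have hle : ∀ i, maxDensity (P i) ≤ maxDensity (dilate (t i) (P i)) := fun i =>
    maxDensity_le_dilate (ht i) (P i)
  refine (Finset.prod_le_prod' fun i _ => hle i).trans ?_
  -- The sum of all `t i * D i` serves as a common separation distance.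
  have h := prod_maxDensity_le Finset.univ (P := fun i => dilate (t i) (P i))
    (Finset.sum_nonneg fun i _ => hnn i)
    (fun i _ => ((hD i).dilate (ht i)).mono_dist
      (Finset.single_le_sum (f := fun i => t i * D i) (fun i _ => hnn i) (Finset.mem_univ i)))
    (fun i _ => by
      obtain ⟨J, hJ⟩ := hP i
      exact ENNReal.toReal_pos (hJ.nontriviality.trans_le (hle i)).ne' (maxDensity_ne_top _))
  have heq : (fun A => ∀ i ∈ (Finset.univ : Finset (Fin n)), dilate (t i) (P i) A) =
      conj fun i => dilate (t i) (P i) := by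
    funext A
    simp [conj]
  rw [heq, ← ENNReal.toReal_prod] at h
  exact (ENNReal.toReal_le_toReal (ENNReal.prod_ne_top fun i _ => maxDensity_ne_top _)
    (maxDensity_ne_top _)).1 h

end Conjunction

end Supersaturation

/-! ### The main theorem -/

theorem mainTheorem2 (d : ℕ) (hd : 2 ≤ d) (n : ℕ) (P : Fin n → Supersaturation.SetProperty d)
    (hP : ∀ i, Supersaturation.Supersaturable (P i)) :
    (∀ t : Fin n → ℝ, (∀ i, 0 < t i) →
      ∏ i, Supersaturation.maxDensity (P i) ≤
        Supersaturation.maxDensity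
          (Supersaturation.conj fun i => Supersaturation.dilate (t i) (P i))) ∧
    (∀ (ι : Type*) (l : Filter ι) (t : Fin n → ι → ℝ), (∀ i s, 0 < t i s) →
      (∀ i j, i ≠ j →
        Tendsto (fun s => t i s / t j s) l (𝓝 0) ∨ Tendsto (fun s => t i s / t j s) l atTop) →
      Tendsto
        (fun s => Supersaturation.maxDensity
          (Supersaturation.conj fun i => Supersaturation.dilate (t i s) (P i)))
        l (𝓝 (∏ i, Supersaturation.maxDensity (P i)))) := by
  refine ⟨fun t ht => Supersaturation.prod_maxDensity_le_dilate hP ht, fun ι l t ht hratio => ?_⟩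
  have hfin : ∏ i, Supersaturation.maxDensity (P i) ≠ ∞ :=
    ENNReal.prod_ne_top fun i _ => Supersaturation.maxDensity_ne_top _
  rw [← ENNReal.tendsto_toReal_iff (fun _ => Supersaturation.maxDensity_ne_top _) hfin,
    tendsto_order]
  refine ⟨fun c hc => Eventually.of_forall fun x => hc.trans_le ?_, fun c hc => ?_⟩
  · exact ENNReal.toReal_mono (Supersaturation.maxDensity_ne_top _)
      (Supersaturation.prod_maxDensity_le_dilate hP fun i => ht i x)
  · rw [ENNReal.toReal_prod] at hc
    filter_upwards [Supersaturation.eventually_maxDensity_lt hP ht hratio Finset.univ hc] with x hx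
    simp only [Finset.mem_univ, forall_const] at hx
    exact hx
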